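/- Let $\mathcal X$ be a measurable space, let $f:\mathcal X\to\mathbb R^d$ be a measurable embedding, and let $p_g$ (generator) and $p_{\mathrm r}$ (real data) be probability distributions on $\mathcal X$. Suppose that $\|f(X_g)\|_2\le C$ almost surely for $X_g\sim p_g$, where $C>0$, and that $f(X_{\mathrm r})$, $X_{\mathrm r}\sim p_{\mathrm r}$, is square-integrable. Let $\mu_g,\Sigma_g$ and $\mu_{\mathrm r},\Sigma_{\mathrm r}$ be the means and covariance matrices of $f(X_g)$ and $f(X_{\mathrm r})$, and assume that $\Sigma_{\mathrm r}$ is positive definite. For a mean vector $\mu$ and a covariance matrix $\Sigma$ put $$\mathrm{FD}(\mu,\Sigma)=\|\mu-\mu_{\mathrm r}\|_2^2+\mathrm{Tr}\big[\Sigma+\Sigma_{\mathrm r}-2(\Sigma\Sigma_{\mathrm r})^{1/2}\big],$$ where $(\cdot)^{1/2}$ is the principal square root, i.e. the diagonalizable square root with nonnegative eigenvalues. Let $n\ge 1$, let $x^1,\dots,x^n$ be i.i.d. samples from $p_g$, put $\widehat\mu_g^n=\frac1n\sum_{i=1}^n f(x^i)$, $\widehat\Sigma_g^n=\frac1n\sum_{i=1}^n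 (f(x^i)-\widehat\mu_g^n)(f(x^i)-\widehat\mu_g^n)^\top$, and let $\mathrm{FD}_g=\mathrm{FD}(\mu_g,\Sigma_g)$ and $\widetilde{\mathrm{FD}}{}_g^n=\mathrm{FD}(\widehat\mu_g^n,\widehat\Sigma_g^n)$. Let $\kappa$ be any constant such that $\|y^\top(f(X_g)-\mu_g)\|_{\psi_2}\le\kappa\sqrt{y^\top\Sigma_g y}$ for all $y\in\mathbb R^d$, where $\|Z\|_{\psi_2}=\inf\{t>0:\mathbb E[\exp(Z^2/t^2)]\le 2\}$. Let $\|\cdot\|_2$ denote the spectral norm on matrices and $\mathbf r(\Sigma_g)=\mathrm{Tr}[\Sigma_g]/\|\Sigma_g\|_2$ the effective rank (read as $0$ if $\Sigma_g=0$). For $0<\delta<1$ define $$\Delta_1^n=\sqrt{\frac{2dC^2}{n}\log\Big(\frac{6d}{\delta}\Big)+\frac{\mathrm{Tr}[\Sigma_g]}{n}},\qquad \Delta_2^n=20\kappa^2\|\Sigma_g\|_2\sqrt{\frac{4\mathbf r(\Sigma_g)+\log(3/\delta)}{n}}+(\Delta_1^n)^2,$$ $$\mathcal C_g^n=2\big(\Delta_1^n+\|\widehat\mu_g^n-\mu_{\mathrm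 r}\|_2\big)\Delta_1^n+\mathrm{Tr}\big[\Sigma_{\mathrm r}^{1/2}\big]\sqrt{8\Delta_2^n}+4C^2\sqrt{\frac1{2n}\log\Big(\frac3\delta\Big)}.$$ Then, with probability at least $1-\delta$, $$\widetilde{\mathrm{FD}}{}_g^n-\mathcal C_g^n\le \mathrm{FD}_g.$$ -/

import Mathlib

open MeasureTheory ProbabilityTheory

/-- `S` is a principal square root of the real square matrix `A`: `S * S = A`, and `S` is
diagonalizable over `ℝ` with nonnegative eigenvalues. By `IsPrincipalSqrt.unique` there is at most
one such `S`, and by `exists_isPrincipalSqrt_mul` there is one for the product of a positive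
semidefinite and a positive definite matrix. -/
def IsPrincipalSqrt {d : ℕ} (A S : Matrix (Fin d) (Fin d) ℝ) : Prop :=
  S * S = A ∧ ∃ (U : (Matrix (Fin d) (Fin d) ℝ)ˣ) (D : Fin d → ℝ),
    (∀ i, 0 ≤ D i) ∧ S = U.val * Matrix.diagonal D * U⁻¹.val

theorem IsPrincipalSqrt.unique {d : ℕ} {A S T : Matrix (Fin d) (Fin d) ℝ}
    (hS : IsPrincipalSqrt A S) (hT : IsPrincipalSqrt A T) : S = T := by
  obtain ⟨hSA, U, D, hD, rfl⟩ := hS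
  obtain ⟨hTA, V, E, hE, rfl⟩ := hT
  have h2 : Matrix.diagonal D * (Matrix.diagonal D * (U⁻¹.val * V.val))
      = U⁻¹.val * V.val * Matrix.diagonal E * Matrix.diagonal E := by
    have h := congrArg (fun M => U⁻¹.val * M * V.val) (hSA.trans hTA.symm)
    simpa [mul_assoc] using h
  have h1 : Matrix.diagonal D * (U⁻¹.val * V.val) = (U⁻¹.val * V.val) * Matrix.diagonal E := by
    ext i j
    have h := congrFun (congrFun h2 i) j
    simp only [Matrix.diagonal_mul, Matrix.mul_diagonal] at h ⊢
    rcases eq_or_ne ((U⁻¹.val * V.val) i j) 0 with h0 | h0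
    · rw [h0, mul_zero, zero_mul]
    · have h3 : D i ^ 2 = E j ^ 2 := by
        apply mul_right_cancel₀ h0
        linear_combination h
      rw [(sq_eq_sq₀ (hD i) (hE j)).1 h3, mul_comm]
  have h := congrArg (fun M => U.val * M * V⁻¹.val) h1
  simpa [mul_assoc] using h

open scoped MatrixOrder Matrix.Norms.L2Operator in
theorem exists_isPrincipalSqrt_mul {d : ℕ} {A B : Matrix (Fin d) (Fin d) ℝ}
    (hA : A.PosSemidef) (hB : B.PosDef) : ∃ S, IsPrincipalSqrt (A * B) S := by
  obtain ⟨C, hC⟩ : ∃ C : (Matrix (Fin d) (Fin d) ℝ)ˣ, B = C.val.conjTranspose * C.val := by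
    obtain ⟨C, hC⟩ := CStarAlgebra.nonneg_iff_eq_star_mul_self.mp hB.posSemidef.nonneg
    have hu : IsUnit C := by
      rw [Matrix.isUnit_iff_isUnit_det]
      have := (Matrix.isUnit_iff_isUnit_det _).1 hB.isUnit
      rw [hC, Matrix.det_mul] at this
      exact isUnit_of_mul_isUnit_right this
    exact ⟨hu.unit, hC⟩
  have hM := hA.mul_mul_conjTranspose_same C.val
  set Q := Unitary.toUnits hM.1.eigenvectorUnitary
  have hspec : C.val * A * C.val.conjTranspose
      = Q.val * Matrix.diagonal hM.1.eigenvalues * Q⁻¹.val := by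
    have := hM.1.spectral_theorem
    rw [Unitary.conjStarAlgAut_apply] at this
    exact this
  refine ⟨_, ?_, C⁻¹ * Q, fun i => √(hM.1.eigenvalues i), fun i => Real.sqrt_nonneg _, rfl⟩
  have hDD : Matrix.diagonal (fun i => √(hM.1.eigenvalues i)) *
      Matrix.diagonal (fun i => √(hM.1.eigenvalues i)) = Matrix.diagonal hM.1.eigenvalues := by
    rw [Matrix.diagonal_mul_diagonal]
    congr 1
    ext i
    exact Real.mul_self_sqrt (hM.eigenvalues_nonneg i)
  have key : C⁻¹.val * (C.val * A * C.val.conjTranspose) * C.val = A * B := by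
    rw [hC]; simp [mul_assoc]
  have key2 := congrArg (fun M => C⁻¹.val * M * C.val) (hspec.trans (by rw [← hDD]))
  refine Eq.trans ?_ (key2.symm.trans key)
  simp only [mul_assoc, mul_inv_rev, inv_inv, Units.val_mul, Units.mul_inv_cancel_left,
    Units.inv_mul_cancel_left]

noncomputable section

open Classical in
/-- The principal square root `A ^ (1/2)` of a real square matrix (and `0` if there is none). -/
def matSqrt {d : ℕ} (A : Matrix (Fin d) (Fin d) ℝ) : Matrix (Fin d) (Fin d) ℝ :=
  if h : ∃ S, IsPrincipalSqrt A S then h.choose else 0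

theorem matSqrt_eq {d : ℕ} {A S : Matrix (Fin d) (Fin d) ℝ} (hS : IsPrincipalSqrt A S) :
    matSqrt A = S := by
  have h : ∃ S, IsPrincipalSqrt A S := ⟨S, hS⟩
  rw [matSqrt, dif_pos h]
  exact h.choose_spec.unique hS

/-- The spectral norm (operator norm with respect to the Euclidean norm) of a matrix. -/
def specNorm {d : ℕ} (A : Matrix (Fin d) (Fin d) ℝ) : ℝ :=
  ‖Matrix.toEuclideanCLM (n := Fin d) (𝕜 := ℝ) A‖

/-- The effective rank `Tr A / ‖A‖₂`. -/
def effRank {d : ℕ} (A : Matrix (Fin d) (Fin d) ℝ) : ℝ :=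
  A.trace / specNorm A

/-- The Fréchet distance formula
`‖m₁ - m₂‖² + Tr (S₁ + S₂ - 2 (S₁ S₂) ^ (1/2))` in terms of means and covariance matrices. -/
def frechetDist {d : ℕ} (m₁ : EuclideanSpace ℝ (Fin d)) (S₁ : Matrix (Fin d) (Fin d) ℝ)
    (m₂ : EuclideanSpace ℝ (Fin d)) (S₂ : Matrix (Fin d) (Fin d) ℝ) : ℝ :=
  ‖m₁ - m₂‖ ^ 2 + (S₁ + S₂ - (2 : ℝ) • matSqrt (S₁ * S₂)).trace

/-- The mean vector of the embedding `f` under the distribution `p`. -/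
def embMean {𝒳 : Type*} [MeasurableSpace 𝒳] {d : ℕ} (f : 𝒳 → EuclideanSpace ℝ (Fin d))
    (p : Measure 𝒳) : EuclideanSpace ℝ (Fin d) :=
  ∫ x, f x ∂p

/-- The covariance matrix of the embedding `f` under the distribution `p`. -/
def embCov {𝒳 : Type*} [MeasurableSpace 𝒳] {d : ℕ} (f : 𝒳 → EuclideanSpace ℝ (Fin d))
    (p : Measure 𝒳) : Matrix (Fin d) (Fin d) ℝ :=
  Matrix.of fun i j => cov[fun x => f x i, fun x => f x j; p]

/-- The empirical mean `n⁻¹ ∑ vᵢ`. -/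
def empMean {d n : ℕ} (v : Fin n → EuclideanSpace ℝ (Fin d)) : EuclideanSpace ℝ (Fin d) :=
  (n : ℝ)⁻¹ • ∑ i, v i

/-- The empirical covariance matrix `n⁻¹ ∑ (vᵢ - m) (vᵢ - m)ᵀ`, where `m` is the empirical mean. -/
def empCov {d n : ℕ} (v : Fin n → EuclideanSpace ℝ (Fin d)) : Matrix (Fin d) (Fin d) ℝ :=
  (n : ℝ)⁻¹ • ∑ i, Matrix.vecMulVec (v i - empMean v).ofLp (v i - empMean v).ofLp

/-- The sub-Gaussian norm `inf {t > 0 : E exp (Z² / t²) ≤ 2}`, as an extended real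
(`⊤` if there is no such `t`). -/
def psi2Norm {𝒳 : Type*} [MeasurableSpace 𝒳] (Z : 𝒳 → ℝ) (p : Measure 𝒳) : ENNReal :=
  ⨅ (t : ℝ) (_ : 0 < t) (_ : ∫⁻ x, ENNReal.ofReal (Real.exp (Z x ^ 2 / t ^ 2)) ∂p ≤ 2),
    ENNReal.ofReal t

/-- `κ` is a constant such that the centered embedding satisfies
`‖yᵀ (f - μ)‖_ψ₂ ≤ κ (yᵀ Σ y) ^ (1/2)` for all `y`, where `μ` and `Σ` are the mean vector and the
covariance matrix of `f`. -/
def IsSubGaussianConst {𝒳 : Type*} [MeasurableSpace 𝒳] {d : ℕ}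
    (f : 𝒳 → EuclideanSpace ℝ (Fin d)) (p : Measure 𝒳) (κ : ℝ) : Prop :=
  ∀ y : EuclideanSpace ℝ (Fin d),
    psi2Norm (fun x => inner ℝ y (f x - embMean f p)) p
      ≤ ENNReal.ofReal (κ * √(y.ofLp ⬝ᵥ Matrix.mulVec (embCov f p) y.ofLp))

/-- The error level `Δ₁` for the mean, at sample size `n`, confidence `δ`, norm bound `C` and
covariance matrix `S`. -/
def meanErr {d : ℕ} (n : ℕ) (δ C : ℝ) (S : Matrix (Fin d) (Fin d) ℝ) : ℝ :=
  √(2 * d * C ^ 2 / n * Real.log (6 * d / δ) + S.trace / n)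

/-- The error level `Δ₂` for the covariance matrix. -/
def covErr {d : ℕ} (n : ℕ) (δ C κ : ℝ) (S : Matrix (Fin d) (Fin d) ℝ) : ℝ :=
  20 * κ ^ 2 * specNorm S * √((4 * effRank S + Real.log (3 / δ)) / n) + meanErr n δ C S ^ 2

/-- The bonus, where `m` is the empirical mean, `S` the covariance matrix of the generator, and
`mr`, `Sr` are the mean and the covariance matrix of the real data. -/
def boundedBonus {d : ℕ} (n : ℕ) (δ C κ : ℝ) (m : EuclideanSpace ℝ (Fin d))
    (S : Matrix (Fin d) (Fin d) ℝ) (mr : EuclideanSpace ℝ (Fin d))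
    (Sr : Matrix (Fin d) (Fin d) ℝ) : ℝ :=
  2 * (meanErr n δ C S + ‖m - mr‖) * meanErr n δ C S
    + (matSqrt Sr).trace * √(8 * covErr n δ C κ S)
    + 4 * C ^ 2 * √(1 / (2 * n) * Real.log (3 / δ))

end

/-!
Comparing the two Fréchet distances leaves three differences: of the squared distances of the
means, of the traces `Tr Σ̂ - Tr Σ`, and of the cross terms `Tr (Σ Σᵣ)^(1/2) - Tr (Σ̂ Σᵣ)^(1/2)`.

For the cross term, `Tr (Σ Σᵣ)^(1/2)` is the trace of the positive semidefinite square root of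
`Σᵣ^(1/2) Σ Σᵣ^(1/2)`, and a positive semidefinite `S` satisfies `2 Tr S ≤ Tr (S² P⁻¹) + Tr P` for
every positive definite `P`. Since the right-hand side is monotone in `S²`, the one-sided estimate
`Σ ≤ Σ̂ + ε` costs only `√ε Tr Σᵣ^(1/2)`.

The estimate `Σ ≤ Σ̂ + ε` needs an `ε` depending on the dimension only through the effective rank,
uniformly in the direction. This is a PAC-Bayes bound: the exponential inequality for a fixed
direction is averaged over the standard Gaussian law, and by the Cameron–Martin formula and Jensen's
inequality the average over a Gaussian centred at `v` costs `‖v‖² / 2` in the exponent. Averaging a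
quadratic form over that Gaussian adds its trace, so the trace of the empirical form has to be
bounded as well. Being a lower tail of nonnegative variables, the inequality for a fixed direction
follows from a second moment.

Hoeffding's inequality controls each coordinate of the mean, and also `‖f - μ‖²`, whose expectation
is `Tr Σ`. Each of the three bounds fails with probability at most `δ / 3`.
-/

section MatrixSquareRoot

open Matrix
open scoped MatrixOrder Matrix.Norms.L2Operator

section TraceInequalities

variable {m : Type*} [Fintype m] {A B P S T L : Matrix m m ℝ}

theorem trace_mul_nonneg_of_posSemidef (hA : A.PosSemidef) (hB : B.PosSemidef) :
    0 ≤ (A * B).trace := by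
  classical
  obtain ⟨R, rfl⟩ := CStarAlgebra.nonneg_iff_eq_star_mul_self.mp hB.nonneg
  have h := (hA.mul_mul_conjTranspose_same R).trace_nonneg
  rwa [mul_assoc, trace_mul_comm, mul_assoc] at h

theorem two_mul_trace_le_trace_mul_inv_add_trace [DecidableEq m] (hS : S.IsHermitian)
    (hP : P.PosDef) :
    2 * S.trace ≤ (S * S * P⁻¹).trace + P.trace := by
  have hu : IsUnit P.det := (isUnit_iff_isUnit_det _).1 hP.isUnit
  have hsquare : 0 ≤ ((S - P) * P⁻¹ * (S - P)).trace := by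
    simpa only [(hS.sub hP.1).eq] using
      (hP.inv.posSemidef.mul_mul_conjTranspose_same (S - P)).trace_nonneg
  have hexpand : (S - P) * P⁻¹ * (S - P) = S * P⁻¹ * S - S - S + P := by
    simp only [sub_mul, mul_sub, mul_nonsing_inv P hu, one_mul, mul_assoc, nonsing_inv_mul P hu,
      mul_one]
    abel
  rw [hexpand, trace_add, trace_sub, trace_sub, mul_assoc, trace_mul_comm S, mul_assoc,
    trace_mul_comm P⁻¹] at hsquare
  linarith

theorem trace_mul_self_mul_inv_le [DecidableEq m] (hS : S.PosSemidef) (hP : P.PosDef)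
    (hSP : S ≤ P) : (S * S * P⁻¹).trace ≤ S.trace := by
  have hu : IsUnit P.det := (isUnit_iff_isUnit_det _).1 hP.isUnit
  have hadj : (S * P⁻¹)ᴴ = P⁻¹ * S := by rw [conjTranspose_mul, hS.1.eq, hP.1.inv.eq]
  have hfst : 0 ≤ ((1 - S * P⁻¹) * S * (1 - P⁻¹ * S)).trace := by
    have h := (hS.mul_mul_conjTranspose_same (1 - S * P⁻¹)).trace_nonneg
    rwa [conjTranspose_sub, conjTranspose_one, hadj] at h
  have hsnd : 0 ≤ (S * P⁻¹ * (P - S) * (P⁻¹ * S)).trace := by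
    have h := (PosSemidef.mul_mul_conjTranspose_same hSP (S * P⁻¹)).trace_nonneg
    rwa [hadj] at h
  have hsum : (1 - S * P⁻¹) * S * (1 - P⁻¹ * S) + S * P⁻¹ * (P - S) * (P⁻¹ * S)
      = S - S * P⁻¹ * S := by
    have : P * (P⁻¹ * S) = S := by rw [← mul_assoc, mul_nonsing_inv P hu, one_mul]
    simp only [sub_mul, mul_sub, one_mul, mul_one, mul_assoc, this]
    abel
  have htrace := congrArg trace hsum
  rw [trace_add, trace_sub, mul_assoc S P⁻¹ S, trace_mul_comm S (P⁻¹ * S), mul_assoc P⁻¹,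
    trace_mul_comm P⁻¹ (S * S)] at htrace
  linarith

theorem trace_le_trace_add_trace_of_mul_self_le (hS : S.IsHermitian) (hT : T.PosSemidef)
    (hL : L.PosDef) (h : S * S ≤ T * T + L * L) : S.trace ≤ T.trace + L.trace := by
  classical
  have hP : (T + L).PosDef := PosDef.posSemidef_add hT hL
  have hSP := two_mul_trace_le_trace_mul_inv_add_trace hS hP
  have hTP := trace_mul_self_mul_inv_le hT hP (le_add_of_nonneg_right hL.posSemidef.nonneg)
  have hLP := trace_mul_self_mul_inv_le hL.posSemidef hP (le_add_of_nonneg_left hT.nonneg)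
  have hmono := trace_mul_nonneg_of_posSemidef h hP.inv.posSemidef
  simp only [sub_mul, add_mul, trace_sub, trace_add] at hSP hmono
  linarith

end TraceInequalities

variable {d : ℕ} {A A' B S : Matrix (Fin d) (Fin d) ℝ}

theorem IsPrincipalSqrt.of_posSemidef (hS : S.PosSemidef) : IsPrincipalSqrt (S * S) S :=
  ⟨rfl, Unitary.toUnits hS.1.eigenvectorUnitary, hS.1.eigenvalues, hS.eigenvalues_nonneg,
    hS.1.spectral_theorem.trans (Unitary.conjStarAlgAut_apply _ _)⟩

theorem IsPrincipalSqrt.conj (h : IsPrincipalSqrt A S) (V : (Matrix (Fin d) (Fin d) ℝ)ˣ) :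
    IsPrincipalSqrt (V⁻¹.val * A * V.val) (V⁻¹.val * S * V.val) := by
  obtain ⟨rfl, U, D, hD, rfl⟩ := h
  exact ⟨by simp [mul_assoc], V⁻¹ * U, D, hD, by simp [mul_assoc]⟩

theorem matSqrt_eq_cfcSqrt (hA : A.PosSemidef) : matSqrt A = CFC.sqrt A :=
  matSqrt_eq <| by
    simpa only [CFC.sqrt_mul_sqrt_self A hA.nonneg] using
      IsPrincipalSqrt.of_posSemidef (nonneg_iff_posSemidef.1 (CFC.sqrt_nonneg A))

theorem matSqrt_trace_nonneg (hA : A.PosSemidef) : 0 ≤ (matSqrt A).trace := by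
  rw [matSqrt_eq_cfcSqrt hA]
  exact (nonneg_iff_posSemidef.1 (CFC.sqrt_nonneg A)).trace_nonneg

theorem matSqrt_mul_eq_conj {R : (Matrix (Fin d) (Fin d) ℝ)ˣ}
    (hA : (R.val * A * R.val).PosSemidef) :
    matSqrt (A * (R.val * R.val)) = R⁻¹.val * CFC.sqrt (R.val * A * R.val) * R.val := by
  have hconj : R⁻¹.val * (R.val * A * R.val) * R.val = A * (R.val * R.val) := by
    simp only [mul_assoc, Units.inv_mul_cancel_left]
  refine matSqrt_eq (hconj ▸ IsPrincipalSqrt.conj ?_ R)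
  simpa only [CFC.sqrt_mul_sqrt_self _ hA.nonneg] using
    IsPrincipalSqrt.of_posSemidef (nonneg_iff_posSemidef.1 (CFC.sqrt_nonneg (R.val * A * R.val)))

theorem trace_matSqrt_mul (hA : A.PosSemidef) (hB : B.PosDef) :
    (matSqrt (A * B)).trace = (CFC.sqrt (CFC.sqrt B * A * CFC.sqrt B)).trace := by
  have hsq : CFC.sqrt B * CFC.sqrt B = B := CFC.sqrt_mul_sqrt_self B hB.posSemidef.nonneg
  have hu : IsUnit (CFC.sqrt B) := (CFC.isUnit_sqrt_iff B hB.posSemidef.nonneg).2 hB.isUnit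
  have hconj : (CFC.sqrt B * A * CFC.sqrt B).PosSemidef :=
    nonneg_iff_posSemidef.1 ((CFC.sqrt_nonneg B).isSelfAdjoint.conjugate_nonneg hA.nonneg)
  have h := matSqrt_mul_eq_conj (R := hu.unit) hconj
  rw [IsUnit.unit_spec, hsq] at h
  rw [h, trace_mul_comm, ← mul_assoc, hu.mul_val_inv, one_mul]

theorem trace_matSqrt_mul_le_of_pos {ε : ℝ} (hε : 0 < ε) (hA : A.PosSemidef) (hA' : A'.PosSemidef)
    (hB : B.PosDef) (h : A ≤ A' + ε • (1 : Matrix (Fin d) (Fin d) ℝ)) :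
    (matSqrt (A * B)).trace ≤ (matSqrt (A' * B)).trace + √ε * (matSqrt B).trace := by
  rw [trace_matSqrt_mul hA hB, trace_matSqrt_mul hA' hB, matSqrt_eq_cfcSqrt hB.posSemidef]
  have hR : IsSelfAdjoint (CFC.sqrt B) := (CFC.sqrt_nonneg B).isSelfAdjoint
  have hRpos : (CFC.sqrt B).PosDef :=
    (nonneg_iff_posSemidef.1 (CFC.sqrt_nonneg B)).posDef_iff_isUnit.2
      ((CFC.isUnit_sqrt_iff B hB.posSemidef.nonneg).2 hB.isUnit)
  set R := CFC.sqrt B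
  have hle : CFC.sqrt (R * A * R) * CFC.sqrt (R * A * R)
      ≤ CFC.sqrt (R * A' * R) * CFC.sqrt (R * A' * R) + (√ε • R) * (√ε • R) := by
    rw [CFC.sqrt_mul_sqrt_self _ (hR.conjugate_nonneg hA.nonneg),
      CFC.sqrt_mul_sqrt_self _ (hR.conjugate_nonneg hA'.nonneg)]
    simpa only [smul_mul_assoc, mul_smul_comm, smul_smul, Real.mul_self_sqrt hε.le, mul_add,
      add_mul, mul_one] using hR.conjugate_le_conjugate h
  simpa only [trace_smul, smul_eq_mul] using
    trace_le_trace_add_trace_of_mul_self_le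
      (nonneg_iff_posSemidef.1 (CFC.sqrt_nonneg (R * A * R))).1
      (nonneg_iff_posSemidef.1 (CFC.sqrt_nonneg (R * A' * R)))
      (hRpos.smul (Real.sqrt_pos.2 hε)) hle

theorem trace_matSqrt_mul_le {ε : ℝ} (hε : 0 ≤ ε) (hA : A.PosSemidef) (hA' : A'.PosSemidef)
    (hB : B.PosDef) (h : A ≤ A' + ε • (1 : Matrix (Fin d) (Fin d) ℝ)) :
    (matSqrt (A * B)).trace ≤ (matSqrt (A' * B)).trace + √ε * (matSqrt B).trace := by
  have hlim : Filter.Tendsto (fun η => (matSqrt (A' * B)).trace + √η * (matSqrt B).trace)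
      (nhdsWithin ε (Set.Ioi ε)) (nhds ((matSqrt (A' * B)).trace + √ε * (matSqrt B).trace)) :=
    (show Continuous _ by fun_prop).continuousWithinAt
  refine ge_of_tendsto hlim (eventually_mem_nhdsWithin.mono fun η hη => ?_)
  refine trace_matSqrt_mul_le_of_pos (hε.trans_lt hη) hA hA' hB (h.trans ?_)
  exact add_le_add_right (smul_le_smul_of_nonneg_right (le_of_lt hη) zero_le_one) A'

end MatrixSquareRoot

section ExponentialMoments

variable {Ω : Type*} [MeasurableSpace Ω] {P : Measure Ω} {F G : Ω → ℝ} {ι : Type*} [Fintype ι]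
  {U : ι → Ω → ℝ}

/-- The exponential moment `E exp F`. It takes values in the extended reals, so that an upper bound
for it carries the integrability of `exp F`. -/
noncomputable def expMoment (F : Ω → ℝ) (P : Measure Ω) : ENNReal :=
  ∫⁻ ω, ENNReal.ofReal (Real.exp (F ω)) ∂P

theorem expMoment_mono (h : ∀ ω, F ω ≤ G ω) : expMoment F P ≤ expMoment G P :=
  lintegral_mono fun ω => ENNReal.ofReal_le_ofReal (Real.exp_le_exp.2 (h ω))

theorem expMoment_sub_const_le_one {c : ℝ} (h : expMoment F P ≤ ENNReal.ofReal (Real.exp c)) :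
    expMoment (fun ω => F ω - c) P ≤ 1 := by
  have hfactor : expMoment (fun ω => F ω - c) P
      = expMoment F P * ENNReal.ofReal (Real.exp (-c)) := by
    simp only [expMoment, sub_eq_add_neg, Real.exp_add, ENNReal.ofReal_mul (Real.exp_nonneg _)]
    exact lintegral_mul_const' _ _ ENNReal.ofReal_ne_top
  calc expMoment (fun ω => F ω - c) P
      ≤ ENNReal.ofReal (Real.exp c) * ENNReal.ofReal (Real.exp (-c)) := by
        rw [hfactor]; gcongr
    _ = 1 := by
        rw [← ENNReal.ofReal_mul (Real.exp_nonneg _), ← Real.exp_add, add_neg_cancel,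
          Real.exp_zero, ENNReal.ofReal_one]

theorem expMoment_comp_of_hasLaw {𝒳 : Type*} [MeasurableSpace 𝒳] {p : Measure 𝒳} {X : Ω → 𝒳}
    {V : 𝒳 → ℝ} (hX : HasLaw X p P) (hV : Measurable V) :
    expMoment (fun ω => V (X ω)) P = expMoment V p :=
  hX.lintegral_comp (f := fun x => ENNReal.ofReal (Real.exp (V x))) (by fun_prop)

theorem expMoment_sum_of_iIndepFun (hindep : iIndepFun U P) (hU : ∀ i, AEMeasurable (U i) P) :
    expMoment (fun ω => ∑ i, U i ω) P = ∏ i, expMoment (U i) P := by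
  have hexp : Measurable fun x : ℝ => ENNReal.ofReal (Real.exp x) := by fun_prop
  have hmk : ∀ i, (fun ω => ENNReal.ofReal (Real.exp (U i ω)))
      =ᵐ[P] fun ω => ENNReal.ofReal (Real.exp ((hU i).mk _ ω)) := fun i =>
    (hU i).ae_eq_mk.fun_comp fun x => ENNReal.ofReal (Real.exp x)
  have hprod := lintegral_prod_eq_prod_lintegral_of_indepFun Finset.univ
    (fun i ω => ENNReal.ofReal (Real.exp ((hU i).mk _ ω)))
    ((hindep.congr fun i => (hU i).ae_eq_mk).comp _ fun _ => hexp)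
    (fun i => hexp.comp (hU i).measurable_mk)
  simp only [expMoment, fun i => lintegral_congr_ae (hmk i), ← hprod]
  refine lintegral_congr_ae ?_
  filter_upwards [ae_all_iff.2 hmk] with ω hω
  rw [Real.exp_sum, ENNReal.ofReal_prod_of_nonneg fun _ _ => Real.exp_nonneg _]
  exact Finset.prod_congr rfl fun i _ => hω i

theorem expMoment_sum_sub_le_one {c : ι → ℝ} (hindep : iIndepFun U P)
    (hU : ∀ i, AEMeasurable (U i) P)
    (h : ∀ i, expMoment (U i) P ≤ ENNReal.ofReal (Real.exp (c i))) :
    expMoment (fun ω => ∑ i, U i ω - ∑ i, c i) P ≤ 1 := by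
  simp only [← Finset.sum_sub_distrib]
  rw [expMoment_sum_of_iIndepFun (U := fun i ω => U i ω - c i)
    (hindep.comp (fun i x => x - c i) fun i => by fun_prop) fun i => by fun_prop]
  exact Finset.prod_le_one' fun i _ => expMoment_sub_const_le_one (h i)

theorem measure_le_le_exp_neg (hF : AEMeasurable F P) (h : expMoment F P ≤ 1) (s : ℝ) :
    P {ω | s ≤ F ω} ≤ ENNReal.ofReal (Real.exp (-s)) := by
  have hset : {ω | s ≤ F ω}
      = {ω | ENNReal.ofReal (Real.exp s) ≤ ENNReal.ofReal (Real.exp (F ω))} := by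
    ext ω
    rw [Set.mem_ofPred_eq, Set.mem_ofPred_eq, ENNReal.ofReal_le_ofReal_iff (Real.exp_nonneg _),
      Real.exp_le_exp]
  calc P {ω | s ≤ F ω} ≤ expMoment F P / ENNReal.ofReal (Real.exp s) := by
        rw [hset]
        exact meas_ge_le_lintegral_div (by fun_prop) (by simp [Real.exp_pos]) (by simp)
    _ ≤ ENNReal.ofReal (Real.exp (-s)) := by
        rw [Real.exp_neg, ENNReal.ofReal_inv_of_pos (Real.exp_pos s), div_eq_mul_inv]
        exact mul_le_of_le_one_left' h

theorem integrable_exp_of_expMoment_ne_top (hF : AEStronglyMeasurable F P)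
    (h : expMoment F P ≠ ⊤) : Integrable (fun ω => Real.exp (F ω)) P :=
  ⟨Real.continuous_exp.comp_aestronglyMeasurable hF,
    (hasFiniteIntegral_iff_ofReal (.of_forall fun _ => Real.exp_nonneg _)).2 h.lt_top⟩

theorem expMoment_eq_ofReal_integral (h : Integrable (fun ω => Real.exp (F ω)) P) :
    expMoment F P = ENNReal.ofReal (∫ ω, Real.exp (F ω) ∂P) :=
  (ofReal_integral_eq_lintegral_ofReal h (.of_forall fun _ => Real.exp_nonneg _)).symm

theorem ofReal_exp_integral_le_expMoment [IsProbabilityMeasure P] (hF : Integrable F P) :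
    ENNReal.ofReal (Real.exp (∫ ω, F ω ∂P)) ≤ expMoment F P := by
  by_cases htop : expMoment F P = ⊤
  · exact htop ▸ le_top
  have hexp := integrable_exp_of_expMoment_ne_top hF.1 htop
  rw [expMoment_eq_ofReal_integral hexp]
  exact ENNReal.ofReal_le_ofReal (convexOn_exp.map_integral_le Real.continuous_exp.continuousOn
    isClosed_univ (.of_forall fun _ => Set.mem_univ _) hF hexp)

end ExponentialMoments

section FrameForm

variable {E : Type*} [NormedAddCommGroup E] {ι : Type*} [Fintype ι]

/-- The trace `∑ₖ ‖bₖ‖²` of the quadratic form `frameForm b` below. -/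
def frameTrace (b : ι → E) : ℝ := ∑ k, ‖b k‖ ^ 2

theorem frameTrace_nonneg (b : ι → E) : 0 ≤ frameTrace b :=
  Finset.sum_nonneg fun _ _ => sq_nonneg _

variable [InnerProductSpace ℝ E]

/-- The quadratic form `v ↦ ∑ₖ ⟪bₖ, v⟫²` of a finite family of vectors. Both covariance forms and
empirical covariance forms are of this shape. -/
def frameForm (b : ι → E) (v : E) : ℝ := ∑ k, inner ℝ (b k) v ^ 2

theorem frameForm_nonneg (b : ι → E) (v : E) : 0 ≤ frameForm b v :=
  Finset.sum_nonneg fun _ _ => sq_nonneg _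

theorem frameForm_le_frameTrace_mul (b : ι → E) (v : E) :
    frameForm b v ≤ frameTrace b * ‖v‖ ^ 2 := by
  rw [frameForm, frameTrace, Finset.sum_mul]
  refine Finset.sum_le_sum fun k _ => ?_
  rw [← mul_pow, ← sq_abs]
  exact pow_le_pow_left₀ (abs_nonneg _) (abs_real_inner_le_norm _ _) 2

theorem continuous_frameForm (b : ι → E) : Continuous (frameForm b) := by
  unfold frameForm
  fun_prop

theorem frameForm_smul_family (c : ℝ) (b : ι → E) (v : E) :
    frameForm (fun k => c • b k) v = frameForm b (c • v) := by
  simp only [frameForm, real_inner_smul_left, real_inner_smul_right]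

theorem frameTrace_smul_family (c : ℝ) (b : ι → E) :
    frameTrace (fun k => c • b k) = c ^ 2 * frameTrace b := by
  simp only [frameTrace, norm_smul, mul_pow, Real.norm_eq_abs, sq_abs, Finset.mul_sum]

theorem frameForm_add_le (b : ι → E) (v w : E) :
    frameForm b (v + w) ≤ 2 * frameForm b v + 2 * frameForm b w := by
  simp only [frameForm, Finset.mul_sum, ← Finset.sum_add_distrib, inner_add_right]
  exact Finset.sum_le_sum fun k _ => by
    linarith [add_sq_le (a := inner ℝ (b k) v) (b := inner ℝ (b k) w)]

theorem sq_frameForm_add_le (b : ι → E) (v w : E) :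
    frameForm b (v + w) ^ 2 ≤ 8 * frameForm b v ^ 2 + 8 * frameForm b w ^ 2 :=
  calc frameForm b (v + w) ^ 2 ≤ (2 * frameForm b v + 2 * frameForm b w) ^ 2 :=
        pow_le_pow_left₀ (frameForm_nonneg b _) (frameForm_add_le b v w) 2
    _ ≤ 8 * frameForm b v ^ 2 + 8 * frameForm b w ^ 2 := by
        linarith [add_sq_le (a := 2 * frameForm b v) (b := 2 * frameForm b w)]

theorem sq_frameForm_le (b : ι → E) (v : E) :
    frameForm b v ^ 2 ≤ frameTrace b * ∑ k, (‖b k‖ ^ 2)⁻¹ * inner ℝ (b k) v ^ 4 := by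
  have hfactor : ∀ k, ‖b k‖ * (‖b k‖⁻¹ * inner ℝ (b k) v ^ 2) = inner ℝ (b k) v ^ 2 := by
    intro k
    rcases eq_or_ne (b k) 0 with hk | hk
    · simp [hk]
    · rw [mul_inv_cancel_left₀ (norm_ne_zero_iff.2 hk)]
  have hcauchy := Finset.sum_mul_sq_le_sq_mul_sq Finset.univ (fun k => ‖b k‖)
    (fun k => ‖b k‖⁻¹ * inner ℝ (b k) v ^ 2)
  simpa only [frameForm, frameTrace, hfactor, mul_pow, inv_pow, ← pow_mul, Nat.reduceMul]
    using hcauchy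

end FrameForm

section GaussianMoments

theorem deriv_mul_exp_mul_sq_div_two {p p' : ℝ → ℝ} (v : ℝ) (hp : ∀ t, HasDerivAt p (p' t) t) :
    deriv (fun t => p t * Real.exp (v * t ^ 2 / 2))
      = fun t => (p' t + v * t * p t) * Real.exp (v * t ^ 2 / 2) := by
  ext t
  have hsq : HasDerivAt (fun t => v * t ^ 2 / 2) (v * t) t :=
    (((hasDerivAt_pow 2 t).const_mul v).div_const 2).congr_deriv (by ring)
  exact ((hp t).mul hsq.exp).deriv.trans (by ring)

theorem iteratedDeriv_four_exp_mul_sq_div_two_zero (v : ℝ) :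
    iteratedDeriv 4 (fun t => Real.exp (v * t ^ 2 / 2)) 0 = 3 * v ^ 2 := by
  have hfst : deriv (fun t => Real.exp (v * t ^ 2 / 2))
      = fun t => v * t * Real.exp (v * t ^ 2 / 2) := by
    simpa using deriv_mul_exp_mul_sq_div_two v fun t => hasDerivAt_const t 1
  have hsnd : deriv (fun t => v * t * Real.exp (v * t ^ 2 / 2))
      = fun t => (v + v ^ 2 * t ^ 2) * Real.exp (v * t ^ 2 / 2) := by
    rw [deriv_mul_exp_mul_sq_div_two v fun t => (hasDerivAt_id' t).const_mul v]
    ring_nf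
  have htrd : deriv (fun t => (v + v ^ 2 * t ^ 2) * Real.exp (v * t ^ 2 / 2))
      = fun t => (3 * v ^ 2 * t + v ^ 3 * t ^ 3) * Real.exp (v * t ^ 2 / 2) := by
    rw [deriv_mul_exp_mul_sq_div_two v fun t =>
      ((hasDerivAt_pow 2 t).const_mul (v ^ 2)).const_add v]
    ring_nf
  have hfth : deriv (fun t => (3 * v ^ 2 * t + v ^ 3 * t ^ 3) * Real.exp (v * t ^ 2 / 2)) 0
      = 3 * v ^ 2 := by
    rw [deriv_mul_exp_mul_sq_div_two v fun t =>
      ((hasDerivAt_id' t).const_mul (3 * v ^ 2)).fun_add ((hasDerivAt_pow 3 t).const_mul (v ^ 3))]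
    simp
  rw [iteratedDeriv_succ', iteratedDeriv_succ', iteratedDeriv_succ', iteratedDeriv_one, hfst, hsnd,
    htrd, hfth]

theorem integral_pow_four_gaussianReal (v : NNReal) :
    ∫ x, x ^ 4 ∂(gaussianReal 0 v) = 3 * (v : ℝ) ^ 2 := by
  have hmgf : mgf id (gaussianReal 0 v) = fun t => Real.exp (v * t ^ 2 / 2) := by
    simp [mgf_id_gaussianReal]
  have hmoment := iteratedDeriv_mgf_zero (X := id) (μ := gaussianReal 0 v) (by
    simp [integrableExpSet_id_gaussianReal]) 4
  rw [hmgf, iteratedDeriv_four_exp_mul_sq_div_two_zero] at hmoment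
  simpa using hmoment.symm

variable {E : Type*} [NormedAddCommGroup E] [InnerProductSpace ℝ E] [FiniteDimensional ℝ E]
  [MeasurableSpace E] [BorelSpace E]

theorem hasLaw_inner_stdGaussian (a : E) :
    HasLaw (fun x => inner ℝ a x) (gaussianReal 0 (‖a‖₊ ^ 2)) (stdGaussian E) where
  map_eq := by
    have h := IsGaussian.map_eq_gaussianReal (μ := stdGaussian E) (innerSL ℝ a)
    rwa [integral_strongDual_stdGaussian, variance_dual_stdGaussian, innerSL_apply_norm,
      Real.toNNReal_pow (norm_nonneg _), norm_toNNReal] at h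

theorem integrable_inner_pow_stdGaussian (a : E) (k : ℕ) :
    Integrable (fun x : E => inner ℝ a x ^ k) (stdGaussian E) := by
  have hLp : MemLp (fun x : E => inner ℝ a x) k (stdGaussian E) :=
    IsGaussian.memLp_dual (stdGaussian E) (innerSL ℝ a) k (by simp)
  exact hLp.integrable_norm_pow'.mono' (by fun_prop) (.of_forall fun x => (norm_pow _ _).le)

theorem integrable_inner_stdGaussian (a : E) :
    Integrable (fun x : E => inner ℝ a x) (stdGaussian E) := by
  simpa only [pow_one] using integrable_inner_pow_stdGaussian a 1

theorem integral_inner_stdGaussian (a : E) : ∫ x : E, inner ℝ a x ∂(stdGaussian E) = 0 :=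
  integral_strongDual_stdGaussian (innerSL ℝ a)

theorem integral_inner_sq_stdGaussian (a : E) :
    ∫ x : E, inner ℝ a x ^ 2 ∂(stdGaussian E) = ‖a‖ ^ 2 := by
  have h := variance_dual_stdGaussian (innerSL ℝ a)
  rwa [variance_of_integral_eq_zero (by fun_prop) (integral_strongDual_stdGaussian _),
    innerSL_apply_norm] at h

theorem integral_inner_pow_four_stdGaussian (a : E) :
    ∫ x : E, inner ℝ a x ^ 4 ∂(stdGaussian E) = 3 * ‖a‖ ^ 4 := by
  have h := (hasLaw_inner_stdGaussian a).integral_comp (f := fun y : ℝ => y ^ 4) (by fun_prop)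
  rw [integral_pow_four_gaussianReal] at h
  simpa [← pow_mul] using h

variable {ι : Type*} [Fintype ι] (b : ι → E) (v : E)

theorem integrable_inner_add_sq_stdGaussian (a : E) :
    Integrable (fun x : E => inner ℝ a (v + x) ^ 2) (stdGaussian E) := by
  simp only [inner_add_right, add_sq]
  exact ((integrable_const _).add ((integrable_inner_stdGaussian a).const_mul _)).add
    (integrable_inner_pow_stdGaussian a 2)

theorem integral_inner_add_sq_stdGaussian (a : E) :
    ∫ x : E, inner ℝ a (v + x) ^ 2 ∂(stdGaussian E) = inner ℝ a v ^ 2 + ‖a‖ ^ 2 := by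
  have hlin := (integrable_inner_stdGaussian a).const_mul (2 * inner ℝ a v)
  have hsum : Integrable (fun x => inner ℝ a v ^ 2 + 2 * inner ℝ a v * inner ℝ a x)
      (stdGaussian E) := (integrable_const _).add hlin
  simp only [inner_add_right, add_sq]
  rw [integral_add hsum (integrable_inner_pow_stdGaussian a 2),
    integral_add (integrable_const _) hlin, integral_const_mul, integral_inner_stdGaussian,
    integral_inner_sq_stdGaussian]
  simp

theorem integrable_frameForm_add_stdGaussian :
    Integrable (fun x => frameForm b (v + x)) (stdGaussian E) :=
  integrable_finsetSum _ fun k _ => integrable_inner_add_sq_stdGaussian v (b k)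

theorem integral_frameForm_add_stdGaussian :
    ∫ x, frameForm b (v + x) ∂(stdGaussian E) = frameForm b v + frameTrace b := by
  simp only [frameForm, frameTrace]
  rw [integral_finsetSum _ fun k _ => integrable_inner_add_sq_stdGaussian v (b k),
    ← Finset.sum_add_distrib]
  simp only [integral_inner_add_sq_stdGaussian]

theorem integrable_frameForm_sq_bound_stdGaussian :
    Integrable (fun x => frameTrace b * ∑ k, (‖b k‖ ^ 2)⁻¹ * inner ℝ (b k) x ^ 4)
      (stdGaussian E) :=
  (integrable_finsetSum _ fun k _ =>
    (integrable_inner_pow_stdGaussian (b k) 4).const_mul _).const_mul _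

theorem integrable_frameForm_sq_stdGaussian :
    Integrable (fun x => frameForm b x ^ 2) (stdGaussian E) :=
  (integrable_frameForm_sq_bound_stdGaussian b).mono'
    ((continuous_frameForm b).pow 2).aestronglyMeasurable
    (.of_forall fun x => by
      rw [Real.norm_of_nonneg (sq_nonneg _)]
      exact sq_frameForm_le b x)

theorem integral_frameForm_sq_stdGaussian_le :
    ∫ x, frameForm b x ^ 2 ∂(stdGaussian E) ≤ 3 * frameTrace b ^ 2 := by
  have hterm : ∀ k, (‖b k‖ ^ 2)⁻¹ * (3 * ‖b k‖ ^ 4) = 3 * ‖b k‖ ^ 2 := by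
    intro k
    rcases eq_or_ne (b k) 0 with hk | hk
    · simp [hk]
    · have : ‖b k‖ ≠ 0 := norm_ne_zero_iff.2 hk
      field_simp
  calc ∫ x, frameForm b x ^ 2 ∂(stdGaussian E)
      ≤ ∫ x, frameTrace b * ∑ k, (‖b k‖ ^ 2)⁻¹ * inner ℝ (b k) x ^ 4 ∂(stdGaussian E) :=
        integral_mono (integrable_frameForm_sq_stdGaussian b)
          (integrable_frameForm_sq_bound_stdGaussian b) (sq_frameForm_le b)
    _ = frameTrace b * ∑ k, 3 * ‖b k‖ ^ 2 := by
        rw [integral_const_mul, integral_finsetSum _ fun k _ =>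
          (integrable_inner_pow_stdGaussian (b k) 4).const_mul _]
        simp only [integral_const_mul, integral_inner_pow_four_stdGaussian, hterm]
    _ = 3 * frameTrace b ^ 2 := by
        rw [← Finset.mul_sum, frameTrace]
        ring

theorem integrable_frameForm_add_sq_stdGaussian :
    Integrable (fun x => frameForm b (v + x) ^ 2) (stdGaussian E) :=
  ((integrable_const (8 * frameForm b v ^ 2)).add
    ((integrable_frameForm_sq_stdGaussian b).const_mul 8)).mono'
    (((continuous_frameForm b).comp (by fun_prop)).pow 2).aestronglyMeasurable
    (.of_forall fun x => by
      rw [Real.norm_of_nonneg (sq_nonneg _)]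
      exact sq_frameForm_add_le b v x)

theorem integral_frameForm_add_sq_stdGaussian_le :
    ∫ x, frameForm b (v + x) ^ 2 ∂(stdGaussian E)
      ≤ 8 * frameForm b v ^ 2 + 24 * frameTrace b ^ 2 := by
  have hsq := (integrable_frameForm_sq_stdGaussian b).const_mul 8
  calc ∫ x, frameForm b (v + x) ^ 2 ∂(stdGaussian E)
      ≤ ∫ x, (8 * frameForm b v ^ 2 + 8 * frameForm b x ^ 2) ∂(stdGaussian E) :=
        integral_mono (integrable_frameForm_add_sq_stdGaussian b v)
          ((integrable_const _).add hsq) (sq_frameForm_add_le b v)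
    _ = 8 * frameForm b v ^ 2 + 8 * ∫ x, frameForm b x ^ 2 ∂(stdGaussian E) := by
        rw [integral_add (integrable_const _) hsq, integral_const, probReal_univ, one_smul,
          integral_const_mul]
    _ ≤ 8 * frameForm b v ^ 2 + 24 * frameTrace b ^ 2 := by
        linarith [integral_frameForm_sq_stdGaussian_le b]

end GaussianMoments

section CameronMartin

variable {E : Type*} [NormedAddCommGroup E] [InnerProductSpace ℝ E] [FiniteDimensional ℝ E]
  [MeasurableSpace E] [BorelSpace E]

theorem integral_exp_neg_sq_norm_mul_cexp_inner (t : E) :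
    ∫ x : E, Real.exp (-‖x‖ ^ 2 / 2) * Complex.exp (inner ℝ x t * Complex.I)
      = ((2 * Real.pi) ^ (Module.finrank ℝ E / 2 : ℝ) : ℝ) * Complex.exp (-‖t‖ ^ 2 / 2) := by
  have hpi : (Real.pi / (1 / 2) : ℂ) ^ (Module.finrank ℝ E / 2 : ℂ)
      = ((2 * Real.pi) ^ (Module.finrank ℝ E / 2 : ℝ) : ℝ) := by
    rw [Complex.ofReal_cpow (by positivity)]
    push_cast
    ring_nf
  have hexp : Complex.exp (Complex.I ^ 2 * ‖t‖ ^ 2 / (4 * (1 / 2)))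
      = Complex.exp (-‖t‖ ^ 2 / 2) := by
    rw [Complex.I_sq]
    ring_nf
  rw [← hpi, ← hexp,
    ← GaussianFourier.integral_cexp_neg_mul_sq_norm_add (by norm_num) Complex.I t]
  refine integral_congr_ae (.of_forall fun x => ?_)
  dsimp only
  rw [Complex.ofReal_exp, ← Complex.exp_add, real_inner_comm]
  push_cast
  ring_nf

theorem integrable_exp_neg_sq_norm : Integrable fun x : E => Real.exp (-‖x‖ ^ 2 / 2) := by
  have h := GaussianFourier.integrable_cexp_neg_mul_sq_norm_add (V := E) (b := 1 / 2)
    (by norm_num) 0 0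
  refine h.norm.congr (.of_forall fun x => ?_)
  simp only [Complex.norm_exp, inner_zero_left, Complex.ofReal_zero, mul_zero, add_zero,
    ← Complex.ofReal_pow, Complex.re_mul_ofReal]
  norm_num
  ring

theorem stdGaussian_eq_withDensity :
    stdGaussian E = (volume : Measure E).withDensity fun x =>
      ENNReal.ofReal (((2 * Real.pi) ^ (Module.finrank ℝ E / 2 : ℝ))⁻¹
        * Real.exp (-‖x‖ ^ 2 / 2)) := by
  set c : ℝ := (2 * Real.pi) ^ (Module.finrank ℝ E / 2 : ℝ)
  have hc : 0 < c := by positivity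
  have : IsFiniteMeasure ((volume : Measure E).withDensity fun x =>
      ENNReal.ofReal (c⁻¹ * Real.exp (-‖x‖ ^ 2 / 2))) :=
    isFiniteMeasure_withDensity_ofReal (integrable_exp_neg_sq_norm.const_mul _).2
  refine Measure.ext_of_charFun (funext fun t => ?_)
  calc charFun (stdGaussian E) t
      = (c⁻¹ : ℝ) * ∫ x : E, Real.exp (-‖x‖ ^ 2 / 2) * Complex.exp (inner ℝ x t * Complex.I) := by
        rw [charFun_stdGaussian, integral_exp_neg_sq_norm_mul_cexp_inner, ← mul_assoc,
          ← Complex.ofReal_mul, inv_mul_cancel₀ hc.ne', Complex.ofReal_one, one_mul]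
    _ = charFun _ t := by
        rw [charFun_apply, integral_withDensity_eq_integral_toReal_smul (by fun_prop) (by simp),
          ← integral_const_mul]
        refine integral_congr_ae (.of_forall fun x => ?_)
        dsimp only
        rw [ENNReal.toReal_ofReal (by positivity), Complex.real_smul, Complex.ofReal_mul, mul_assoc]

theorem lintegral_stdGaussian_eq_lintegral_add (F : E → ENNReal) (v : E) :
    ∫⁻ x, F x ∂(stdGaussian E) =
      ∫⁻ x, F (v + x) * ENNReal.ofReal (Real.exp (-inner ℝ v x - ‖v‖ ^ 2 / 2))
        ∂(stdGaussian E) := by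
  have hfinite : ∀ᵐ x : E, ENNReal.ofReal (((2 * Real.pi) ^ (Module.finrank ℝ E / 2 : ℝ))⁻¹
      * Real.exp (-‖x‖ ^ 2 / 2)) < ⊤ := .of_forall fun _ => ENNReal.ofReal_lt_top
  rw [stdGaussian_eq_withDensity,
    lintegral_withDensity_eq_lintegral_mul_non_measurable _ (by fun_prop) hfinite,
    lintegral_withDensity_eq_lintegral_mul_non_measurable _ (by fun_prop) hfinite,
    ← lintegral_add_left_eq_self _ v]
  refine lintegral_congr fun x => ?_
  simp only [Pi.mul_apply]
  rw [mul_comm (F _), ← mul_assoc, ← ENNReal.ofReal_mul (by positivity), mul_assoc, ← Real.exp_add,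
    norm_add_sq_real]
  congr 4
  ring

-- Jensen's inequality after translation: `‖v‖² / 2` is the relative entropy of the translated law.
theorem ofReal_exp_integral_add_sub_le_expMoment {F : E → ℝ} {v : E}
    (hF : Integrable (fun x => F (v + x)) (stdGaussian E)) :
    ENNReal.ofReal (Real.exp (∫ x, F (v + x) ∂(stdGaussian E) - ‖v‖ ^ 2 / 2))
      ≤ expMoment F (stdGaussian E) := by
  have htilt : Integrable (fun x : E => -inner ℝ v x - ‖v‖ ^ 2 / 2) (stdGaussian E) :=
    (integrable_inner_stdGaussian v).neg.sub (integrable_const _)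
  have hintegral : ∫ x, (F (v + x) + (-inner ℝ v x - ‖v‖ ^ 2 / 2)) ∂(stdGaussian E)
      = ∫ x, F (v + x) ∂(stdGaussian E) - ‖v‖ ^ 2 / 2 := by
    rw [integral_add hF htilt,
      integral_sub (integrable_inner_stdGaussian v).fun_neg (integrable_const _), integral_neg,
      integral_inner_stdGaussian, integral_const, probReal_univ, one_smul]
    ring
  have hmoment : expMoment F (stdGaussian E)
      = expMoment (fun x => F (v + x) + (-inner ℝ v x - ‖v‖ ^ 2 / 2)) (stdGaussian E) := by
    rw [expMoment, lintegral_stdGaussian_eq_lintegral_add _ v, expMoment]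
    simp only [← ENNReal.ofReal_mul (Real.exp_nonneg _), ← Real.exp_add]
  rw [hmoment, ← hintegral]
  exact ofReal_exp_integral_le_expMoment (hF.add htilt)

end CameronMartin

section PACBayes

variable {Ω : Type*} [MeasurableSpace Ω] {P : Measure Ω} [IsProbabilityMeasure P]
  {E : Type*} [NormedAddCommGroup E] [InnerProductSpace ℝ E] [FiniteDimensional ℝ E]
  [MeasurableSpace E] [BorelSpace E]

-- The standard Gaussian law is the prior and its translate by `v` the posterior.
theorem measure_exists_le_integral_add_sub_le {F : Ω → E → ℝ}
    (hF : AEMeasurable (Function.uncurry F) (P.prod (stdGaussian E)))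
    (hmoment : ∀ θ, expMoment (F · θ) P ≤ 1) (s : ℝ) :
    P {ω | ∃ v, Integrable (fun x => F ω (v + x)) (stdGaussian E) ∧
      s ≤ ∫ x, F ω (v + x) ∂(stdGaussian E) - ‖v‖ ^ 2 / 2} ≤ ENNReal.ofReal (Real.exp (-s)) := by
  have hmeas : AEMeasurable (Function.uncurry fun ω x => ENNReal.ofReal (Real.exp (F ω x)))
      (P.prod (stdGaussian E)) := hF.exp.ennreal_ofReal
  have hmix : ∫⁻ ω, expMoment (F ω) (stdGaussian E) ∂P ≤ 1 := by
    simp only [expMoment]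
    rw [lintegral_lintegral_swap hmeas]
    exact (lintegral_mono hmoment).trans_eq (by simp)
  have hmarkov : P {ω | ENNReal.ofReal (Real.exp s) ≤ expMoment (F ω) (stdGaussian E)}
      ≤ ENNReal.ofReal (Real.exp (-s)) :=
    calc _ ≤ (∫⁻ ω, expMoment (F ω) (stdGaussian E) ∂P) / ENNReal.ofReal (Real.exp s) :=
          meas_ge_le_lintegral_div hmeas.lintegral_prod_right' (by simp [Real.exp_pos]) (by simp)
      _ ≤ ENNReal.ofReal (Real.exp (-s)) := by
          rw [Real.exp_neg, ENNReal.ofReal_inv_of_pos (Real.exp_pos s), div_eq_mul_inv]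
          exact mul_le_of_le_one_left' hmix
  refine (measure_mono ?_).trans hmarkov
  rintro ω ⟨v, hint, hv⟩
  exact (ENNReal.ofReal_le_ofReal (Real.exp_le_exp.2 hv)).trans
    (ofReal_exp_integral_add_sub_le_expMoment hint)

variable {κ ι : Type*} [Fintype κ] [Fintype ι]

theorem le_integral_quadratic_add_stdGaussian (y : κ → E) (b : ι → E) (l m : ℝ) {L : ℝ}
    (hL : 0 ≤ L) (v : E) :
    Integrable (fun x => -l * frameForm y (v + x) - (-m * frameForm b (v + x)
        + L * frameForm b (v + x) ^ 2)) (stdGaussian E) ∧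
      -l * (frameForm y v + frameTrace y) + m * (frameForm b v + frameTrace b)
          - L * (8 * frameForm b v ^ 2 + 24 * frameTrace b ^ 2)
        ≤ ∫ x, (-l * frameForm y (v + x) - (-m * frameForm b (v + x)
          + L * frameForm b (v + x) ^ 2)) ∂(stdGaussian E) := by
  have hy := (integrable_frameForm_add_stdGaussian y v).const_mul (-l)
  have hb := (integrable_frameForm_add_stdGaussian b v).const_mul (-m)
  have hsq := (integrable_frameForm_add_sq_stdGaussian b v).const_mul L
  refine ⟨hy.sub (hb.fun_add hsq), ?_⟩
  rw [integral_sub hy (hb.fun_add hsq), integral_add hb hsq, integral_const_mul, integral_const_mul,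
    integral_const_mul, integral_frameForm_add_stdGaussian, integral_frameForm_add_stdGaussian]
  linarith [mul_le_mul_of_nonneg_left (integral_frameForm_add_sq_stdGaussian_le b v) hL]

theorem measure_exists_le_quadratic_le {Y : κ → Ω → E} (hindep : iIndepFun Y P)
    (hY : ∀ i, AEMeasurable (Y i) P) {b : ι → E} {l L : ℝ} (hL : 0 ≤ L) (s : ℝ)
    (hmoment : ∀ i θ, expMoment (fun ω => -l * inner ℝ (Y i ω) θ ^ 2) P
      ≤ ENNReal.ofReal (Real.exp (-l * frameForm b θ + L * frameForm b θ ^ 2))) :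
    P {ω | ∃ v, s ≤ -l * (frameForm (Y · ω) v + frameTrace (Y · ω))
      + Fintype.card κ * l * (frameForm b v + frameTrace b)
      - Fintype.card κ * L * (8 * frameForm b v ^ 2 + 24 * frameTrace b ^ 2)
      - ‖v‖ ^ 2 / 2} ≤ ENNReal.ofReal (Real.exp (-s)) := by
  set F : Ω → E → ℝ := fun ω θ => -l * frameForm (Y · ω) θ
    - (-(Fintype.card κ * l) * frameForm b θ + Fintype.card κ * L * frameForm b θ ^ 2)
  have hF : AEMeasurable (Function.uncurry F) (P.prod (stdGaussian E)) := by
    have hb : Measurable (frameForm b) := (continuous_frameForm b).measurable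
    simp only [F, Function.uncurry_def, frameForm.eq_1 fun i => Y i _]
    fun_prop
  have hF_moment : ∀ θ, expMoment (F · θ) P ≤ 1 := by
    intro θ
    have h := expMoment_sum_sub_le_one (U := fun i ω => -l * inner ℝ (Y i ω) θ ^ 2)
      (hindep.comp (fun _ y => -l * inner ℝ y θ ^ 2) fun _ => by fun_prop) (fun i => by fun_prop)
      (hmoment · θ)
    convert h using 2
    ext ω
    simp only [F, frameForm.eq_1 fun i => Y i _, Finset.sum_const, Finset.card_univ, nsmul_eq_mul,
      ← Finset.mul_sum]
    ring
  refine (measure_mono ?_).trans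
    (measure_exists_le_integral_add_sub_le hF hF_moment s)
  rintro ω ⟨v, hv⟩
  obtain ⟨hint, hle⟩ := le_integral_quadratic_add_stdGaussian (Y · ω) b l (Fintype.card κ * l)
    (L := Fintype.card κ * L) (by positivity) v
  exact ⟨v, hint, by linarith⟩

theorem measure_exists_le_scaled_quadratic_le {Y : κ → Ω → E}
    (hindep : iIndepFun Y P) (hY : ∀ i, AEMeasurable (Y i) P) {b : ι → E} {l L β : ℝ}
    (hL : 0 ≤ L) (hβ : 0 < β) (s : ℝ)
    (hmoment : ∀ i θ, expMoment (fun ω => -l * inner ℝ (Y i ω) θ ^ 2) P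
      ≤ ENNReal.ofReal (Real.exp (-l * frameForm b θ + L * frameForm b θ ^ 2))) :
    P {ω | ∃ v, s ≤ -l * (frameForm (Y · ω) v + frameTrace (Y · ω) / β)
      + Fintype.card κ * l * (frameForm b v + frameTrace b / β)
      - Fintype.card κ * L * (8 * frameForm b v ^ 2 + 24 * (frameTrace b / β) ^ 2)
      - β * ‖v‖ ^ 2 / 2} ≤ ENNReal.ofReal (Real.exp (-s)) := by
  have hsqrt : √β ≠ 0 := (Real.sqrt_pos.2 hβ).ne'
  have hscaled := measure_exists_le_quadratic_le (b := fun k => (√β)⁻¹ • b k)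
    (hindep.comp (fun _ y => (√β)⁻¹ • y) fun _ => by fun_prop)
    (fun i => (hY i).const_smul (√β)⁻¹) hL s fun i θ => by
      simpa only [Function.comp_apply, real_inner_smul_left, ← real_inner_smul_right,
        frameForm_smul_family] using hmoment i ((√β)⁻¹ • θ)
  refine (measure_mono ?_).trans hscaled
  rintro ω ⟨v, hv⟩
  refine ⟨√β • v, hv.trans_eq ?_⟩
  simp only [Function.comp_apply, frameForm_smul_family, frameTrace_smul_family, smul_smul,
    inv_mul_cancel₀ hsqrt, one_smul, norm_smul, mul_pow, inv_pow, Real.norm_eq_abs, sq_abs,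
    Real.sq_sqrt hβ.le]
  ring

end PACBayes

section ExpInequalities

theorem exp_neg_le_quadratic {x : ℝ} (hx : 0 ≤ x) : Real.exp (-x) ≤ 1 - x + x ^ 2 / 2 := by
  have hpos : 0 < 1 - x + x ^ 2 / 2 := by linarith [sq_nonneg (x - 1)]
  rw [Real.exp_neg, inv_le_comm₀ (Real.exp_pos _) hpos]
  refine le_trans ?_ (Real.quadratic_le_exp_of_nonneg hx)
  rw [inv_le_iff_one_le_mul₀ hpos]
  linarith [sq_nonneg (x ^ 2)]

theorem hasSum_exp_sub_one_sub (x : ℝ) :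
    HasSum (fun n : ℕ => x ^ (n + 2) / (n + 2).factorial) (Real.exp x - 1 - x) := by
  have hexp : HasSum (fun n : ℕ => x ^ n / n.factorial) (Real.exp x) := by
    rw [Real.exp_eq_exp_ℝ]
    exact NormedSpace.expSeries_div_hasSum_exp x
  simpa [Finset.sum_range_succ, sub_sub] using (hasSum_nat_add_iff' 2).2 hexp

theorem exp_mul_le_of_le_one {a u : ℝ} (hu : 0 ≤ u) (ha : a ≤ 1) :
    Real.exp (a * u) ≤ 1 + a * u + a ^ 2 * (Real.exp u - 1 - u) := by
  rcases le_total 0 a with ha₀ | ha₀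
  · have hseries : Real.exp (a * u) - 1 - a * u ≤ a ^ 2 * (Real.exp u - 1 - u) := by
      refine hasSum_le (fun n => ?_) (hasSum_exp_sub_one_sub (a * u))
        ((hasSum_exp_sub_one_sub u).mul_left (a ^ 2))
      rw [← mul_div_assoc, mul_pow]
      gcongr ?_ * _ / _
      exact pow_le_pow_of_le_one ha₀ ha (by omega)
    linarith
  · have hneg := exp_neg_le_quadratic (x := -(a * u)) (by
      linarith [mul_nonpos_of_nonpos_of_nonneg ha₀ hu])
    have hsq := mul_le_mul_of_nonneg_left (Real.quadratic_le_exp_of_nonneg hu) (sq_nonneg a)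
    rw [neg_neg] at hneg
    linarith

end ExpInequalities

section SubexponentialMeans

variable {Ω : Type*} [MeasurableSpace Ω] {P : Measure Ω} {U : Ω → ℝ} {K m : ℝ}

/-- `U` is a nonnegative variable with mean `m` whose sub-exponential norm is at most `K * m`. If
`m = 0` the quotient `U / (K * m)` is `0`, and the exponential moment says nothing; but then `U`
vanishes almost everywhere. -/
structure HasSubexpMean (U : Ω → ℝ) (K m : ℝ) (P : Measure Ω) : Prop where
  nonneg : ∀ ω, 0 ≤ U ω
  integrable : Integrable U P
  integral_eq : ∫ ω, U ω ∂P = m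
  expMoment_le : expMoment (fun ω => U ω / (K * m)) P ≤ 2

theorem HasSubexpMean.mean_nonneg (h : HasSubexpMean U K m P) : 0 ≤ m :=
  h.integral_eq ▸ integral_nonneg h.nonneg

theorem HasSubexpMean.ae_eq_zero (h : HasSubexpMean U K 0 P) : U =ᵐ[P] 0 :=
  (integral_eq_zero_iff_of_nonneg h.nonneg h.integrable).1 h.integral_eq

theorem HasSubexpMean.comp_of_hasLaw {𝒳 : Type*} [MeasurableSpace 𝒳] {p : Measure 𝒳} {X : Ω → 𝒳}
    {V : 𝒳 → ℝ} (h : HasSubexpMean V K m p) (hV : Measurable V) (hX : HasLaw X p P) :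
    HasSubexpMean (fun ω => V (X ω)) K m P where
  nonneg ω := h.nonneg (X ω)
  integrable := (hX.map_eq.symm ▸ h.integrable).comp_aemeasurable hX.aemeasurable
  integral_eq := (hX.integral_comp hV.aestronglyMeasurable).trans h.integral_eq
  expMoment_le :=
    (expMoment_comp_of_hasLaw (V := fun x => V x / (K * m)) hX (by fun_prop)).trans_le
      h.expMoment_le

variable [IsProbabilityMeasure P]

theorem expMoment_mul_le {a : ℝ} (hU : Integrable U P) (hU₀ : ∀ ω, 0 ≤ U ω)
    (h : expMoment U P ≤ 2) (ha : a ≤ 1) :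
    expMoment (fun ω => a * U ω) P ≤ ENNReal.ofReal (Real.exp (a * ∫ ω, U ω ∂P + a ^ 2)) := by
  have hexp := integrable_exp_of_expMoment_ne_top hU.1 (ne_top_of_le_ne_top (by simp) h)
  have hexp_le : ∫ ω, Real.exp (U ω) ∂P ≤ 2 := by
    rwa [expMoment_eq_ofReal_integral hexp, ENNReal.ofReal_le_ofNat] at h
  have hlin : Integrable (fun ω => 1 + a * U ω) P := (integrable_const _).add (hU.const_mul a)
  have hsub : Integrable (fun ω => Real.exp (U ω) - 1) P := hexp.sub (integrable_const _)
  have hrem : Integrable (fun ω => a ^ 2 * (Real.exp (U ω) - 1 - U ω)) P :=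
    (hsub.sub hU).const_mul _
  have hbound : ∫ ω, (1 + a * U ω + a ^ 2 * (Real.exp (U ω) - 1 - U ω)) ∂P
      = 1 + a * ∫ ω, U ω ∂P + a ^ 2 * (∫ ω, Real.exp (U ω) ∂P - 1 - ∫ ω, U ω ∂P) := by
    rw [integral_add hlin hrem, integral_add (integrable_const _) (hU.const_mul a),
      integral_const_mul, integral_const_mul, integral_sub hsub hU,
      integral_sub hexp (integrable_const _)]
    simp only [integral_const, probReal_univ, smul_eq_mul, mul_one]
  calc expMoment (fun ω => a * U ω) P
      ≤ ∫⁻ ω, ENNReal.ofReal (1 + a * U ω + a ^ 2 * (Real.exp (U ω) - 1 - U ω)) ∂P :=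
        lintegral_mono fun ω => ENNReal.ofReal_le_ofReal (exp_mul_le_of_le_one (hU₀ ω) ha)
    _ = ENNReal.ofReal (∫ ω, (1 + a * U ω + a ^ 2 * (Real.exp (U ω) - 1 - U ω)) ∂P) :=
        (ofReal_integral_eq_lintegral_ofReal (hlin.add hrem) (.of_forall fun ω =>
          (Real.exp_nonneg _).trans (exp_mul_le_of_le_one (hU₀ ω) ha))).symm
    _ ≤ ENNReal.ofReal (Real.exp (a * ∫ ω, U ω ∂P + a ^ 2)) := by
        refine ENNReal.ofReal_le_ofReal (hbound.trans_le ?_)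
        have hcoef : ∫ ω, Real.exp (U ω) ∂P - 1 - ∫ ω, U ω ∂P ≤ 1 := by
          linarith [integral_nonneg (μ := P) (f := U) hU₀]
        linarith [mul_le_mul_of_nonneg_left hcoef (sq_nonneg a),
          Real.add_one_le_exp (a * ∫ ω, U ω ∂P + a ^ 2)]

theorem HasSubexpMean.expMoment_mul_div_le {a : ℝ} (h : HasSubexpMean U K m P) (hK : 0 < K)
    (hm : 0 < m) (ha : a ≤ 1) :
    expMoment (fun ω => a * (U ω / (K * m))) P ≤ ENNReal.ofReal (Real.exp (a / K + a ^ 2)) := by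
  have hmean : ∫ ω, U ω / (K * m) ∂P = 1 / K := by
    rw [integral_div, h.integral_eq]
    field_simp
  have hbound := expMoment_mul_le (h.integrable.div_const (K * m))
    (fun ω => div_nonneg (h.nonneg ω) (by positivity)) h.expMoment_le ha
  rwa [hmean, mul_one_div] at hbound

theorem HasSubexpMean.expMoment_neg_mul_le {l : ℝ} (h : HasSubexpMean U K m P) (hK : 0 < K)
    (hl : 0 ≤ l) :
    expMoment (fun ω => -l * U ω) P
      ≤ ENNReal.ofReal (Real.exp (-l * m + (l * K) ^ 2 * m ^ 2)) := by
  rcases h.mean_nonneg.eq_or_lt with rfl | hm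
  · have hzero : expMoment (fun ω => -l * U ω) P = ∫⁻ _, 1 ∂P :=
      lintegral_congr_ae (h.ae_eq_zero.mono fun ω hω => by simp [hω])
    rw [hzero]
    simp
  have hbound := h.expMoment_mul_div_le (a := -l * (K * m)) hK hm (by
    linarith [mul_nonneg hl (mul_pos hK hm).le])
  have hfactor : ∀ ω, -l * (K * m) * (U ω / (K * m)) = -l * U ω := fun ω => by field_simp
  have hexponent : -l * (K * m) / K + (-l * (K * m)) ^ 2 = -l * m + (l * K) ^ 2 * m ^ 2 := by
    field_simp
  simpa only [hfactor, hexponent] using hbound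

theorem HasSubexpMean.one_le (h : HasSubexpMean U K m P) (hK : 0 < K) (hm : 0 < m) : 1 ≤ K := by
  have hexp := (ofReal_exp_integral_le_expMoment (h.integrable.div_const (K * m))).trans
    h.expMoment_le
  rw [integral_div, h.integral_eq, ENNReal.ofReal_le_ofNat] at hexp
  have hquot : m / (K * m) ≤ 1 := by linarith [Real.add_one_le_exp (m / (K * m))]
  rw [div_le_one (by positivity)] at hquot
  exact (le_mul_iff_one_le_left hm).1 hquot

end SubexponentialMeans

section SumsOfSubexponentialMeans

variable {Ω : Type*} [MeasurableSpace Ω] {P : Measure Ω} {ι : Type*} [Fintype ι]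
  {U : ι → Ω → ℝ} {K : ℝ}

theorem expMoment_convexCombination_le {w : ι → ℝ} {c : ENNReal} (hw : ∀ i, 0 ≤ w i)
    (hw₁ : ∑ i, w i = 1) (hU : ∀ i, AEMeasurable (U i) P) (h : ∀ i, expMoment (U i) P ≤ c) :
    expMoment (fun ω => ∑ i, w i * U i ω) P ≤ c := by
  have hconvex : ∀ ω, ENNReal.ofReal (Real.exp (∑ i, w i * U i ω))
      ≤ ∑ i, ENNReal.ofReal (w i) * ENNReal.ofReal (Real.exp (U i ω)) := by
    intro ω
    simp only [← ENNReal.ofReal_mul (hw _)]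
    rw [← ENNReal.ofReal_sum_of_nonneg fun i _ => mul_nonneg (hw i) (Real.exp_nonneg _)]
    exact ENNReal.ofReal_le_ofReal (convexOn_exp.map_sum_le (fun i _ => hw i) hw₁
      fun i _ => Set.mem_univ _)
  calc expMoment (fun ω => ∑ i, w i * U i ω) P
      ≤ ∑ i, ENNReal.ofReal (w i) * expMoment (U i) P := by
        refine (lintegral_mono hconvex).trans_eq ?_
        rw [lintegral_finsetSum' _ fun i _ => by fun_prop]
        exact Finset.sum_congr rfl fun i _ => lintegral_const_mul' _ _ ENNReal.ofReal_ne_top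
    _ ≤ ∑ i, ENNReal.ofReal (w i) * c := by
        gcongr with i
        exact h i
    _ = c := by
        rw [← Finset.sum_mul, ← ENNReal.ofReal_sum_of_nonneg fun i _ => hw i, hw₁,
          ENNReal.ofReal_one, one_mul]

theorem HasSubexpMean.sum {m : ι → ℝ} (h : ∀ i, HasSubexpMean (U i) K (m i) P)
    (hm : 0 < ∑ i, m i) : HasSubexpMean (fun ω => ∑ i, U i ω) K (∑ i, m i) P where
  nonneg ω := Finset.sum_nonneg fun i _ => (h i).nonneg ω
  integrable := integrable_finsetSum _ fun i _ => (h i).integrable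
  integral_eq := by
    rw [integral_finsetSum _ fun i _ => (h i).integrable]
    exact Finset.sum_congr rfl fun i _ => (h i).integral_eq
  expMoment_le := by
    have hcomb := expMoment_convexCombination_le (w := fun i => m i / ∑ j, m j)
      (U := fun i ω => U i ω / (K * m i)) (P := P)
      (fun i => div_nonneg (h i).mean_nonneg hm.le) (by rw [← Finset.sum_div, div_self hm.ne'])
      (fun i => (h i).integrable.aemeasurable.div_const _) fun i => (h i).expMoment_le
    refine le_of_eq_of_le (lintegral_congr_ae ?_) hcomb
    have hvanish : ∀ᵐ ω ∂P, ∀ i, m i = 0 → U i ω = 0 := ae_all_iff.2 fun i => by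
      by_cases hi : m i = 0
      · exact (hi ▸ h i).ae_eq_zero.mono fun ω hω _ => hω
      · exact .of_forall fun ω hω => absurd hω hi
    filter_upwards [hvanish] with ω hω
    congr 2
    rw [Finset.sum_div]
    refine Finset.sum_congr rfl fun i _ => ?_
    rcases eq_or_ne (m i) 0 with hi | hi
    · simp [hω i hi]
    · field_simp

theorem measure_card_mul_le_sum_le [IsProbabilityMeasure P] {m a : ℝ} (hindep : iIndepFun U P)
    (h : ∀ i, HasSubexpMean (U i) K m P) (hK : 0 < K) (hm : 0 < m) (ha₀ : 0 ≤ a) (ha : a ≤ 1) :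
    P {ω | Fintype.card ι * ((1 + 3 * K * a) * m) ≤ ∑ i, U i ω}
      ≤ ENNReal.ofReal (Real.exp (-(2 * (Fintype.card ι * a ^ 2)))) := by
  have hU : ∀ i, AEMeasurable (U i) P := fun i => (h i).integrable.aemeasurable
  have hmoment := expMoment_sum_sub_le_one (U := fun i ω => a * (U i ω / (K * m)))
    (hindep.comp (fun _ x => a * (x / (K * m))) fun _ => by fun_prop) (fun i => by fun_prop)
    fun i => (h i).expMoment_mul_div_le hK hm ha
  refine le_trans (measure_mono fun ω hω => ?_)
    (measure_le_le_exp_neg (by fun_prop) hmoment (2 * (Fintype.card ι * a ^ 2)))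
  rw [Set.mem_ofPred_eq] at hω ⊢
  have hscaled := mul_le_mul_of_nonneg_left hω (show 0 ≤ a / (K * m) by positivity)
  have hleft : a / (K * m) * (Fintype.card ι * ((1 + 3 * K * a) * m))
      = Fintype.card ι * (a / K + 3 * a ^ 2) := by
    field_simp
  have hright : ∑ i, a * (U i ω / (K * m)) = a / (K * m) * ∑ i, U i ω := by
    rw [Finset.mul_sum]
    exact Finset.sum_congr rfl fun i _ => by ring
  simp only [hright, Finset.sum_const, Finset.card_univ, nsmul_eq_mul]
  linarith

end SumsOfSubexponentialMeans

section CovarianceLowerTail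

theorem sub_inv_mul_le_of_quadratic_lt {n N K q a r x y W : ℝ} (hn : 0 < n) (hN : 0 < N)
    (hK : 0 < K) (hq : 0 < q) (haq : a ≤ q) (hr : 0 < r) (hx : 0 ≤ x) (hxN : x ≤ N)
    (hW : W ≤ n * ((1 + 3 * K * a) * (r * N)))
    (hquad : -(q / (2 * K * N)) * (y + W / (8 * r)) + n * (q / (2 * K * N)) * (x + r * N / (8 * r))
      - n * (q / (2 * K * N) * K) ^ 2 * (8 * x ^ 2 + 24 * (r * N / (8 * r)) ^ 2) - 8 * r / 2
      ≤ 2 * (q ^ 2 * n - 4 * r)) :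
    x - n⁻¹ * y ≤ 10 * K * N * q := by
  set l := q / (2 * K * N) with hl
  have hl_pos : 0 < l := by positivity
  have hlKN : l * K * N = q / 2 := by
    rw [hl]
    field_simp
  have htrace : r * N / (8 * r) = N / 8 := by field_simp
  have hW' : l * (W / (8 * r)) ≤ n * l * (N / 8) + 3 / 16 * (q ^ 2 * n) := by
    calc l * (W / (8 * r)) ≤ l * (n * ((1 + 3 * K * a) * (r * N)) / (8 * r)) := by gcongr
      _ = n * l * (N / 8) + 3 / 8 * n * (l * K * N) * a := by
        field_simp
      _ ≤ n * l * (N / 8) + 3 / 8 * n * (l * K * N) * q := by gcongr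
      _ = n * l * (N / 8) + 3 / 16 * (q ^ 2 * n) := by
        rw [hlKN]
        ring
  have hsq : n * (l * K) ^ 2 * (8 * x ^ 2 + 24 * (N / 8) ^ 2) ≤ 67 / 32 * (q ^ 2 * n) := by
    calc n * (l * K) ^ 2 * (8 * x ^ 2 + 24 * (N / 8) ^ 2)
        ≤ n * (l * K) ^ 2 * (8 * N ^ 2 + 24 * (N / 8) ^ 2) := by gcongr
      _ = 67 / 8 * n * (l * K * N) ^ 2 := by ring
      _ = 67 / 32 * (q ^ 2 * n) := by
        rw [hlKN]
        ring
  have hscaled : l * n * (x - n⁻¹ * y) ≤ l * n * (10 * K * N * q) := by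
    have hleft : l * n * (x - n⁻¹ * y) = n * l * x - l * y := by field_simp
    have hright : l * n * (10 * K * N * q) = 5 * (q ^ 2 * n) := by
      calc l * n * (10 * K * N * q) = 10 * n * (l * K * N) * q := by ring
        _ = 5 * (q ^ 2 * n) := by
          rw [hlKN]
          ring
    rw [htrace] at hquad
    rw [hleft, hright]
    linarith [mul_pos (pow_pos hq 2) hn]
  exact le_of_mul_le_mul_left hscaled (mul_pos hl_pos hn)

theorem exp_neg_two_mul_add_self_le {t : ℝ} (ht : Real.log 2 ≤ t) :
    Real.exp (-(2 * t)) + Real.exp (-(2 * t)) ≤ Real.exp (-t) := by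
  have hhalf : Real.exp (-t) ≤ 2⁻¹ := by
    rw [Real.exp_neg]
    exact inv_anti₀ two_pos ((Real.log_le_iff_le_exp two_pos).1 ht)
  have hsq : Real.exp (-(2 * t)) = Real.exp (-t) * Real.exp (-t) := by
    rw [← Real.exp_add]
    ring_nf
  linarith [mul_le_mul_of_nonneg_left hhalf (Real.exp_nonneg (-t))]

variable {E : Type*} [NormedAddCommGroup E] [InnerProductSpace ℝ E] {κ ι : Type*} [Fintype κ]
  [Fintype ι] {b : ι → E} {K N t : ℝ}

theorem frameForm_smul (b : ι → E) (c : ℝ) (v : E) :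
    frameForm b (c • v) = c ^ 2 * frameForm b v := by
  simp only [frameForm, real_inner_smul_right, mul_pow, Finset.mul_sum]

theorem frameTrace_eq_sum_frameForm (b : ι → E) {J : Type*} [Fintype J]
    (e : OrthonormalBasis J ℝ E) : frameTrace b = ∑ j, frameForm b (e j) := by
  simp only [frameTrace, frameForm]
  rw [Finset.sum_comm]
  exact Finset.sum_congr rfl fun k _ => (e.sum_sq_inner_left (b k)).symm

theorem frameForm_sub_le_of_frameTrace_le [Nonempty κ] {y : κ → E} {q a : ℝ} (hK : 0 < K)
    (hT : 0 < frameTrace b) (hN : 0 < N) (hbN : ∀ v, frameForm b v ≤ N * ‖v‖ ^ 2) (hq : 0 < q)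
    (haq : a ≤ q) (hqt : q ^ 2 * Fintype.card κ = 4 * (frameTrace b / N) + t)
    (htrace : frameTrace y ≤ Fintype.card κ * ((1 + 3 * K * a) * frameTrace b))
    (hquad : ∀ v, -(q / (2 * K * N)) * (frameForm y v + frameTrace y / (8 * (frameTrace b / N)))
      + Fintype.card κ * (q / (2 * K * N))
        * (frameForm b v + frameTrace b / (8 * (frameTrace b / N)))
      - Fintype.card κ * (q / (2 * K * N) * K) ^ 2
        * (8 * frameForm b v ^ 2 + 24 * (frameTrace b / (8 * (frameTrace b / N))) ^ 2)
      - 8 * (frameTrace b / N) * ‖v‖ ^ 2 / 2 ≤ 2 * t) (v : E) :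
    frameForm b v - (Fintype.card κ : ℝ)⁻¹ * frameForm y v ≤ 10 * K * N * q * ‖v‖ ^ 2 := by
  have hcard : (0 : ℝ) < Fintype.card κ := by exact_mod_cast Fintype.card_pos
  have hT_eq : frameTrace b = frameTrace b / N * N := by field_simp
  have hunit : ∀ u : E, ‖u‖ = 1 →
      frameForm b u - (Fintype.card κ : ℝ)⁻¹ * frameForm y u ≤ 10 * K * N * q := by
    intro u hu
    have hu_quad := hquad u
    have hu_le := hbN u
    rw [hu, one_pow, mul_one] at hu_quad hu_le
    refine sub_inv_mul_le_of_quadratic_lt hcard hN hK hq haq (div_pos hT hN)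
      (frameForm_nonneg b u) hu_le (W := frameTrace y) ?_ ?_
    · rwa [← hT_eq]
    · rw [← hT_eq]
      linarith
  rcases eq_or_ne v 0 with rfl | hv
  · simp [frameForm]
  · have hv_norm : ‖v‖ ≠ 0 := norm_ne_zero_iff.2 hv
    have h := mul_le_mul_of_nonneg_left (hunit (‖v‖⁻¹ • v) (norm_smul_inv_norm hv)) (sq_nonneg ‖v‖)
    simp only [frameForm_smul] at h
    refine le_of_eq_of_le ?_ (h.trans_eq (mul_comm _ _))
    field_simp

variable [FiniteDimensional ℝ E] {Ω : Type*} [MeasurableSpace Ω] {P : Measure Ω}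

theorem hasSubexpMean_sq_norm {Z : Ω → E} (hT : 0 < frameTrace b)
    (h : ∀ θ, HasSubexpMean (fun ω => inner ℝ (Z ω) θ ^ 2) K (frameForm b θ) P) :
    HasSubexpMean (fun ω => ‖Z ω‖ ^ 2) K (frameTrace b) P := by
  have htrace := frameTrace_eq_sum_frameForm b (stdOrthonormalBasis ℝ E)
  have hsum := HasSubexpMean.sum (fun j => h (stdOrthonormalBasis ℝ E j)) (htrace ▸ hT)
  rw [htrace]
  convert hsum using 2 with ω
  exact ((stdOrthonormalBasis ℝ E).sum_sq_inner_left (Z ω)).symm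

variable [MeasurableSpace E] [BorelSpace E] [IsProbabilityMeasure P] {Y : κ → Ω → E}

theorem measure_exists_lt_frameForm_sub_le_of_le_card [Nonempty κ] (hindep : iIndepFun Y P)
    (hY : ∀ i, AEMeasurable (Y i) P)
    (hsubexp : ∀ i θ, HasSubexpMean (fun ω => inner ℝ (Y i ω) θ ^ 2) K (frameForm b θ) P)
    (hK : 0 < K) (hT : 0 < frameTrace b) (hN : 0 < N) (hbN : ∀ v, frameForm b v ≤ N * ‖v‖ ^ 2)
    (ht : Real.log 2 ≤ t) (htn : t ≤ Fintype.card κ) :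
    P {ω | ∃ v, 10 * K * N * √((4 * (frameTrace b / N) + t) / Fintype.card κ) * ‖v‖ ^ 2
      < frameForm b v - (Fintype.card κ : ℝ)⁻¹ * frameForm (Y · ω) v}
      ≤ ENNReal.ofReal (Real.exp (-t)) := by
  have hcard : (0 : ℝ) < Fintype.card κ := by exact_mod_cast Fintype.card_pos
  have ht₀ : 0 < t := (Real.log_pos one_lt_two).trans_le ht
  have hr : 0 < frameTrace b / N := div_pos hT hN
  set q := √((4 * (frameTrace b / N) + t) / Fintype.card κ) with hq
  set a := √(t / Fintype.card κ) with ha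
  have hq₀ : 0 < q := Real.sqrt_pos.2 (by positivity)
  have hqt : q ^ 2 * Fintype.card κ = 4 * (frameTrace b / N) + t := by
    rw [hq, Real.sq_sqrt (by positivity), div_mul_cancel₀ _ hcard.ne']
  have hat : Fintype.card κ * a ^ 2 = t := by
    rw [ha, Real.sq_sqrt (by positivity), mul_div_cancel₀ _ hcard.ne']
  have ha₁ : a ≤ 1 := by
    rw [ha, Real.sqrt_le_one, div_le_one hcard]
    exact htn
  have haq : a ≤ q := Real.sqrt_le_sqrt (by gcongr; linarith)
  have htrace := measure_card_mul_le_sum_le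
    (hindep.comp (fun _ y => ‖y‖ ^ 2) fun _ => by fun_prop)
    (fun i => hasSubexpMean_sq_norm hT (hsubexp i)) hK hT (Real.sqrt_nonneg _) ha₁
  have hquad := measure_exists_le_scaled_quadratic_le hindep hY (b := b)
    (l := q / (2 * K * N)) (β := 8 * (frameTrace b / N)) (sq_nonneg (q / (2 * K * N) * K))
    (by positivity) (2 * t) fun i θ => (hsubexp i θ).expMoment_neg_mul_le hK (by positivity)
  rw [hat] at htrace
  refine (measure_mono ?_).trans ((measure_union_le _ _).trans
    ((add_le_add htrace hquad).trans ?_))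
  · rintro ω ⟨v, hv⟩
    by_contra hcon
    simp only [Set.mem_union, Set.mem_ofPred_eq, not_or, not_exists, not_le] at hcon
    exact hv.not_ge (frameForm_sub_le_of_frameTrace_le hK hT hN hbN hq₀ haq hqt hcon.1.le
      (fun v => (hcon.2 v).le) v)
  · rw [← ENNReal.ofReal_add (Real.exp_nonneg _) (Real.exp_nonneg _)]
    exact ENNReal.ofReal_le_ofReal (exp_neg_two_mul_add_self_le ht)

theorem measure_exists_lt_frameForm_sub_le [Nonempty κ] (hindep : iIndepFun Y P)
    (hY : ∀ i, AEMeasurable (Y i) P)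
    (hsubexp : ∀ i θ, HasSubexpMean (fun ω => inner ℝ (Y i ω) θ ^ 2) K (frameForm b θ) P)
    (hK : 0 < K) (hT : 0 < frameTrace b) (hN : 0 < N) (hbN : ∀ v, frameForm b v ≤ N * ‖v‖ ^ 2)
    (ht : Real.log 2 ≤ t) :
    P {ω | ∃ v, 10 * K * N * √((4 * (frameTrace b / N) + t) / Fintype.card κ) * ‖v‖ ^ 2
      < frameForm b v - (Fintype.card κ : ℝ)⁻¹ * frameForm (Y · ω) v}
      ≤ ENNReal.ofReal (Real.exp (-t)) := by
  have hcard : (0 : ℝ) < Fintype.card κ := by exact_mod_cast Fintype.card_pos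
  have hr : 0 < frameTrace b / N := div_pos hT hN
  rcases le_or_gt t (Fintype.card κ) with htn | htn
  · exact measure_exists_lt_frameForm_sub_le_of_le_card hindep hY hsubexp hK hT hN hbN ht htn
  refine (measure_mono (t := ∅) ?_).trans (by simp)
  rintro ω ⟨v, hv⟩
  have hK₁ : 1 ≤ K :=
    (hasSubexpMean_sq_norm hT (hsubexp (Classical.arbitrary κ))).one_le hK hT
  have hq : 1 ≤ √((4 * (frameTrace b / N) + t) / Fintype.card κ) := by
    rw [Real.one_le_sqrt, one_le_div hcard]
    linarith
  have hKq := one_le_mul_of_one_le_of_one_le hK₁ hq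
  have htriv : N * ‖v‖ ^ 2
      ≤ 10 * K * N * √((4 * (frameTrace b / N) + t) / Fintype.card κ) * ‖v‖ ^ 2 := by
    linarith [le_mul_of_one_le_left (show 0 ≤ N * ‖v‖ ^ 2 by positivity)
      (show 1 ≤ 10 * (K * √((4 * (frameTrace b / N) + t) / Fintype.card κ)) by linarith)]
  have hemp : 0 ≤ (Fintype.card κ : ℝ)⁻¹ * frameForm (Y · ω) v :=
    mul_nonneg (by positivity) (frameForm_nonneg _ _)
  exact hv.not_ge (by linarith [hbN v])

end CovarianceLowerTail

section CovarianceMatrix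

open scoped MatrixOrder

variable {d : ℕ} {A : Matrix (Fin d) (Fin d) ℝ}

theorem dotProduct_mulVec_le_specNorm (A : Matrix (Fin d) (Fin d) ℝ)
    (v : EuclideanSpace ℝ (Fin d)) : v.ofLp ⬝ᵥ A.mulVec v.ofLp ≤ specNorm A * ‖v‖ ^ 2 := by
  have hinner : v.ofLp ⬝ᵥ A.mulVec v.ofLp
      = inner ℝ v (Matrix.toEuclideanCLM (n := Fin d) (𝕜 := ℝ) A v) := by
    rw [EuclideanSpace.inner_eq_star_dotProduct, Matrix.ofLp_toEuclideanCLM, dotProduct_comm,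
      star_trivial]
  calc v.ofLp ⬝ᵥ A.mulVec v.ofLp
      ≤ ‖v‖ * ‖Matrix.toEuclideanCLM (n := Fin d) (𝕜 := ℝ) A v‖ :=
        hinner.trans_le (real_inner_le_norm _ _)
    _ ≤ ‖v‖ * (specNorm A * ‖v‖) := by
        gcongr
        exact ContinuousLinearMap.le_opNorm _ _
    _ = specNorm A * ‖v‖ ^ 2 := by ring

theorem specNorm_pos (hA : A ≠ 0) : 0 < specNorm A :=
  norm_pos_iff.2 ((map_ne_zero_iff _ (Matrix.toEuclideanCLM (n := Fin d) (𝕜 := ℝ)).injective).2 hA)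

theorem exists_frameForm_eq (hA : A.PosSemidef) : ∃ b : Fin d → EuclideanSpace ℝ (Fin d),
    (∀ v, frameForm b v = v.ofLp ⬝ᵥ A.mulVec v.ofLp) ∧ frameTrace b = A.trace := by
  obtain ⟨R, rfl⟩ := CStarAlgebra.nonneg_iff_eq_star_mul_self.mp hA.nonneg
  refine ⟨fun k => WithLp.toLp 2 (R k), fun v => ?_, ?_⟩
  · have hRv : v.ofLp ⬝ᵥ (star R * R).mulVec v.ofLp = R.mulVec v.ofLp ⬝ᵥ R.mulVec v.ofLp := by
      rw [Matrix.star_eq_conjTranspose, Matrix.conjTranspose_eq_transpose_of_trivial,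
        ← Matrix.mulVec_mulVec, Matrix.dotProduct_mulVec, Matrix.vecMul_transpose]
    rw [hRv]
    refine Finset.sum_congr rfl fun k _ => ?_
    rw [EuclideanSpace.inner_eq_star_dotProduct, star_trivial, dotProduct_comm, sq]
    rfl
  · rw [Matrix.trace_mul_comm]
    refine Finset.sum_congr rfl fun k _ => ?_
    rw [EuclideanSpace.real_norm_sq_eq, Matrix.diag_apply, Matrix.mul_apply]
    exact Finset.sum_congr rfl fun j _ => sq _

variable {𝒳 : Type*} [MeasurableSpace 𝒳] {f : 𝒳 → EuclideanSpace ℝ (Fin d)} {p : Measure 𝒳}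
  [IsProbabilityMeasure p]

theorem memLp_inner_sub_embMean (hf : MemLp f 2 p) (v : EuclideanSpace ℝ (Fin d)) :
    MemLp (fun x => inner ℝ (f x - embMean f p) v) 2 p :=
  (hf.sub (memLp_const _)).inner_const v

theorem dotProduct_embCov_mulVec (hf : MemLp f 2 p) (v : EuclideanSpace ℝ (Fin d)) :
    v.ofLp ⬝ᵥ (embCov f p).mulVec v.ofLp = ∫ x, inner ℝ (f x - embMean f p) v ^ 2 ∂p := by
  have hinner : ∀ x, ∑ i, v i * f x i = inner ℝ v (f x) := fun x => by
    rw [EuclideanSpace.inner_eq_star_dotProduct, star_trivial, dotProduct_comm]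
    rfl
  have hvar : Var[fun x => inner ℝ v (f x); p] = ∫ x, inner ℝ (f x - embMean f p) v ^ 2 ∂p := by
    rw [variance_eq_integral (hf.const_inner v).aemeasurable,
      integral_inner (hf.integrable one_le_two)]
    simp only [← inner_sub_right, real_inner_comm v, embMean]
  rw [← hvar]
  simp only [← hinner]
  rw [variance_fun_sum fun i => (hf.eval_piLp i).const_mul (v i)]
  simp only [covariance_const_mul_left, covariance_const_mul_right, dotProduct, Matrix.mulVec,
    Finset.mul_sum, embCov, Matrix.of_apply]
  exact Finset.sum_congr rfl fun i _ => Finset.sum_congr rfl fun j _ => by ring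

theorem posSemidef_embCov (hf : MemLp f 2 p) : (embCov f p).PosSemidef := by
  refine .of_dotProduct_mulVec_nonneg ?_ fun v => ?_
  · ext i j
    simp [embCov, covariance_comm]
  · rw [star_trivial]
    exact (dotProduct_embCov_mulVec hf (WithLp.toLp 2 v)).symm ▸
      integral_nonneg fun x => sq_nonneg _

theorem trace_embCov (hf : MemLp f 2 p) :
    (embCov f p).trace = ∫ x, ‖f x - embMean f p‖ ^ 2 ∂p := by
  have hcoord : ∀ i, MemLp (fun x => f x i) 2 p := hf.eval_piLp
  have hsub : ∀ i, Integrable (fun x => (f x - embMean f p) i ^ 2) p := fun i =>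
    ((hcoord i).sub (memLp_const _)).integrable_sq
  simp only [EuclideanSpace.real_norm_sq_eq]
  rw [integral_finsetSum _ fun i _ => hsub i]
  refine Finset.sum_congr rfl fun i _ => ?_
  rw [Matrix.diag_apply, embCov, Matrix.of_apply, covariance_self (hcoord i).aemeasurable,
    variance_eq_integral (hcoord i).aemeasurable, embMean,
    ← eval_integral_piLp fun i => (hcoord i).integrable one_le_two]
  rfl

end CovarianceMatrix

section SubGaussianEmbedding

variable {𝒳 : Type*} [MeasurableSpace 𝒳] {d : ℕ} {f : 𝒳 → EuclideanSpace ℝ (Fin d)}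
  {p : Measure 𝒳} {κ K : ℝ}

theorem expMoment_sq_div_sq_le_of_psi2Norm_lt {Z : 𝒳 → ℝ} {t : ℝ}
    (h : psi2Norm Z p < ENNReal.ofReal t) : expMoment (fun x => Z x ^ 2 / t ^ 2) p ≤ 2 := by
  simp only [psi2Norm, iInf_lt_iff] at h
  obtain ⟨s, hs₀, hs, hst⟩ := h
  have hlt : s < t := (ENNReal.ofReal_lt_ofReal_iff_of_nonneg hs₀.le).1 hst
  refine (expMoment_mono fun x => ?_).trans hs
  gcongr

variable [IsProbabilityMeasure p]

theorem IsSubGaussianConst.hasSubexpMean (hκ : IsSubGaussianConst f p κ) (hf : MemLp f 2 p)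
    (hK : κ ^ 2 < K) (v : EuclideanSpace ℝ (Fin d)) :
    HasSubexpMean (fun x => inner ℝ (f x - embMean f p) v ^ 2) K
      (v.ofLp ⬝ᵥ (embCov f p).mulVec v.ofLp) p where
  nonneg x := sq_nonneg _
  integrable := (memLp_inner_sub_embMean hf v).integrable_sq
  integral_eq := (dotProduct_embCov_mulVec hf v).symm
  expMoment_le := by
    set s := v.ofLp ⬝ᵥ (embCov f p).mulVec v.ofLp
    have hs : 0 ≤ s := (posSemidef_embCov hf).dotProduct_mulVec_nonneg v.ofLp
    rcases hs.eq_or_lt with hs₀ | hs₀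
    · simp [expMoment, ← hs₀]
    have hKs : 0 < K * s := mul_pos ((sq_nonneg κ).trans_lt hK) hs₀
    have hlt : κ * √s < √(K * s) := Real.lt_sqrt_of_sq_lt (by
      rw [mul_pow, Real.sq_sqrt hs]
      gcongr)
    have hmoment := expMoment_sq_div_sq_le_of_psi2Norm_lt
      ((hκ v).trans_lt ((ENNReal.ofReal_lt_ofReal_iff (Real.sqrt_pos.2 hKs)).2 hlt))
    simpa only [Real.sq_sqrt hKs.le, real_inner_comm v] using hmoment

theorem IsSubGaussianConst.one_le_sq (hκ : IsSubGaussianConst f p κ) (hf : MemLp f 2 p)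
    (hT : 0 < (embCov f p).trace) : 1 ≤ κ ^ 2 := by
  obtain ⟨b, hb, hbT⟩ := exists_frameForm_eq (posSemidef_embCov hf)
  refine le_of_forall_gt_imp_ge_of_dense fun K hK => ?_
  have hnorm : HasSubexpMean (fun x => ‖f x - embMean f p‖ ^ 2) K (frameTrace b) p :=
    hasSubexpMean_sq_norm (hbT ▸ hT) fun v => hb v ▸ hκ.hasSubexpMean hf hK v
  exact hnorm.one_le ((sq_nonneg κ).trans_lt hK) (hbT ▸ hT)

theorem measure_exists_lt_embCov_sub_le {Ω : Type*} [MeasurableSpace Ω] {P : Measure Ω}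
    [IsProbabilityMeasure P] {n : ℕ} {X : Fin n → Ω → 𝒳} {t : ℝ} (hn : 0 < n)
    (hX : ∀ i, HasLaw (X i) p P) (hindep : iIndepFun X P) (hfm : Measurable f) (hf : MemLp f 2 p)
    (hκ : IsSubGaussianConst f p κ) (ht : Real.log 2 ≤ t) :
    P {ω | ∃ v : EuclideanSpace ℝ (Fin d), 20 * κ ^ 2 * specNorm (embCov f p)
        * √((4 * effRank (embCov f p) + t) / n) * ‖v‖ ^ 2
      < v.ofLp ⬝ᵥ (embCov f p).mulVec v.ofLp
        - (n : ℝ)⁻¹ * frameForm (fun i => f (X i ω) - embMean f p) v}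
      ≤ ENNReal.ofReal (Real.exp (-t)) := by
  have : Nonempty (Fin n) := ⟨⟨0, hn⟩⟩
  obtain ⟨b, hb, hbT⟩ := exists_frameForm_eq (posSemidef_embCov hf)
  simp only [← hb, effRank, ← hbT]
  rcases (frameTrace_nonneg b).eq_or_lt with hT | hT
  · refine (measure_mono (t := ∅) ?_).trans (by simp)
    rintro ω ⟨v, hv⟩
    have hzero := frameForm_le_frameTrace_mul b v
    have hemp : 0 ≤ (n : ℝ)⁻¹ * frameForm (fun i => f (X i ω) - embMean f p) v :=
      mul_nonneg (by positivity) (frameForm_nonneg _ _)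
    have herr : 0 ≤ 20 * κ ^ 2 * specNorm (embCov f p)
        * √((4 * (frameTrace b / specNorm (embCov f p)) + t) / n) * ‖v‖ ^ 2 := by
      have : 0 ≤ specNorm (embCov f p) := norm_nonneg _
      positivity
    rw [← hT, zero_mul] at hzero
    exact hv.not_ge (by linarith)
  have hκ₁ := hκ.one_le_sq hf (hbT ▸ hT)
  have hS : embCov f p ≠ 0 := fun hS => by simp [hbT, hS] at hT
  have htail := measure_exists_lt_frameForm_sub_le (b := b) (K := 2 * κ ^ 2) (t := t)
    (hindep.comp (fun _ x => f x - embMean f p) fun _ => by fun_prop)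
    (fun i => (hfm.comp_aemeasurable (hX i).aemeasurable).sub_const _)
    (fun i v => hb v ▸ (hκ.hasSubexpMean hf (by linarith) v).comp_of_hasLaw (by fun_prop) (hX i))
    (by linarith) hT (specNorm_pos hS) (fun v => hb v ▸ dotProduct_mulVec_le_specNorm _ v) ht
  have hconst : 10 * (2 * κ ^ 2) = 20 * κ ^ 2 := by ring
  rwa [Fintype.card_fin, hconst] at htail

end SubGaussianEmbedding

section Hoeffding

variable {Ω : Type*} [MeasurableSpace Ω] {P : Measure Ω} [IsProbabilityMeasure P] {ι : Type*}
  [Fintype ι] [Nonempty ι] {t : ℝ}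

theorem measure_le_mean_sub_le {Y : ι → Ω → ℝ} {a b m : ℝ} (hindep : iIndepFun Y P)
    (hY : ∀ i, AEMeasurable (Y i) P) (hab : a < b) (hmem : ∀ i, ∀ᵐ ω ∂P, Y i ω ∈ Set.Icc a b)
    (hm : ∀ i, ∫ ω, Y i ω ∂P = m) (ht : 0 ≤ t) :
    P {ω | (b - a) * √(1 / (2 * Fintype.card ι) * t) ≤ (Fintype.card ι : ℝ)⁻¹ * ∑ i, Y i ω - m}
      ≤ ENNReal.ofReal (Real.exp (-t)) := by
  have hcard : (0 : ℝ) < Fintype.card ι := Nat.cast_pos.2 Fintype.card_pos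
  have hsub : ∀ i, HasSubgaussianMGF (fun ω => Y i ω - m) ((‖b - a‖₊ / 2) ^ 2) P := fun i =>
    hm i ▸ hasSubgaussianMGF_of_mem_Icc (hY i) (hmem i)
  have hba : 0 < b - a := sub_pos.2 hab
  have hhoeffding := HasSubgaussianMGF.measure_sum_ge_le_of_iIndepFun (s := Finset.univ)
    (hindep.comp (fun _ x => x - m) fun _ => by fun_prop) (fun i _ => hsub i)
    (ε := Fintype.card ι * ((b - a) * √(1 / (2 * Fintype.card ι) * t))) (by positivity)
  have hexponent : -(Fintype.card ι * ((b - a) * √(1 / (2 * Fintype.card ι) * t))) ^ 2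
      / (2 * ((∑ _i : ι, (‖b - a‖₊ / 2) ^ 2 : NNReal) : ℝ)) = -t := by
    simp only [Finset.sum_const, Finset.card_univ, nsmul_eq_mul]
    push_cast
    rw [Real.norm_of_nonneg hba.le, mul_pow, mul_pow, Real.sq_sqrt (by positivity)]
    field_simp
  rw [hexponent, measureReal_def, ← ENNReal.le_ofReal_iff_toReal_le (measure_ne_top _ _)
    (Real.exp_pos _).le] at hhoeffding
  refine (measure_mono fun ω hω => ?_).trans hhoeffding
  have hscaled := mul_le_mul_of_nonneg_left (Set.mem_ofPred_eq ▸ hω) hcard.le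
  rw [mul_sub, mul_inv_cancel_left₀ hcard.ne'] at hscaled
  simpa only [Set.mem_ofPred_eq, Function.comp_apply, Finset.sum_sub_distrib, Finset.sum_const,
    Finset.card_univ, nsmul_eq_mul] using hscaled

theorem measure_lt_abs_mean_sub_le {Y : ι → Ω → ℝ} {a b m : ℝ} (hindep : iIndepFun Y P)
    (hY : ∀ i, AEMeasurable (Y i) P) (hab : a < b) (hmem : ∀ i, ∀ᵐ ω ∂P, Y i ω ∈ Set.Icc a b)
    (hm : ∀ i, ∫ ω, Y i ω ∂P = m) (ht : 0 ≤ t) :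
    P {ω | (b - a) * √(1 / (2 * Fintype.card ι) * t) < |(Fintype.card ι : ℝ)⁻¹ * ∑ i, Y i ω - m|}
      ≤ 2 * ENNReal.ofReal (Real.exp (-t)) := by
  have hupper := measure_le_mean_sub_le hindep hY hab hmem hm ht
  have hlower := measure_le_mean_sub_le (hindep.comp (fun _ x => -x) fun _ => measurable_neg)
    (fun i => (hY i).neg) (neg_lt_neg hab)
    (fun i => (hmem i).mono fun ω h => ⟨neg_le_neg h.2, neg_le_neg h.1⟩)
    (fun i => (integral_neg _).trans (congrArg Neg.neg (hm i))) ht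
  refine (measure_mono fun ω hω => ?_).trans
    (((measure_union_le _ _).trans (add_le_add hupper hlower)).trans_eq (two_mul _).symm)
  simp only [Set.mem_union, Set.mem_ofPred_eq, Function.comp_apply, Finset.sum_neg_distrib,
    lt_abs] at hω ⊢
  exact hω.imp le_of_lt fun h => by linarith

theorem measure_lt_norm_mean_sub_le {J : Type*} [Fintype J] {Y : ι → Ω → EuclideanSpace ℝ J}
    {m : EuclideanSpace ℝ J} {C : ℝ} (hindep : iIndepFun Y P) (hY : ∀ i, AEMeasurable (Y i) P)
    (hC : 0 < C) (hbound : ∀ i, ∀ᵐ ω ∂P, ‖Y i ω‖ ≤ C) (hm : ∀ i, ∫ ω, Y i ω ∂P = m)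
    (ht : 0 ≤ t) :
    P {ω | √(2 * Fintype.card J * C ^ 2 / Fintype.card ι * t)
        < ‖(Fintype.card ι : ℝ)⁻¹ • ∑ i, Y i ω - m‖}
      ≤ ENNReal.ofReal (2 * Fintype.card J * Real.exp (-t)) := by
  have hint : ∀ i, Integrable (Y i) P := fun i => .of_bound (hY i).aestronglyMeasurable C (hbound i)
  have hcoord : ∀ j, P {ω | (C - -C) * √(1 / (2 * Fintype.card ι) * t)
      < |(Fintype.card ι : ℝ)⁻¹ * ∑ i, Y i ω j - m j|}
      ≤ 2 * ENNReal.ofReal (Real.exp (-t)) := fun j =>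
    measure_lt_abs_mean_sub_le (hindep.comp (fun _ y => y j) fun _ => by fun_prop)
      (fun i => by fun_prop) (neg_lt_self hC)
      (fun i => (hbound i).mono fun ω h => abs_le.1 ((PiLp.norm_apply_le (Y i ω) j).trans h))
      (fun i => by rw [← hm i, eval_integral_piLp fun j => (hint i).eval_piLp j]) ht
  have hsq : ((C - -C) * √(1 / (2 * Fintype.card ι) * t)) ^ 2
      = 2 * C ^ 2 / Fintype.card ι * t := by
    rw [mul_pow, Real.sq_sqrt (by positivity)]
    ring
  have hunion := (measure_iUnion_fintype_le P _).trans (Finset.sum_le_sum fun j _ => hcoord j)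
  refine (measure_mono fun ω hω => ?_).trans (hunion.trans_eq ?_)
  · by_contra hcon
    simp only [Set.mem_iUnion, Set.mem_ofPred_eq, not_exists, not_lt] at hcon
    refine hω.not_ge (Real.le_sqrt_of_sq_le ?_)
    rw [EuclideanSpace.norm_sq_eq]
    refine (Finset.sum_le_card_nsmul _ _ (2 * C ^ 2 / Fintype.card ι * t) fun j _ => ?_).trans_eq ?_
    · rw [← hsq]
      refine pow_le_pow_left₀ (norm_nonneg _) ?_ 2
      simpa using hcon j
    · rw [Finset.card_univ, nsmul_eq_mul]
      ring
  · rw [Finset.sum_const, Finset.card_univ, nsmul_eq_mul, mul_comm 2 (Fintype.card J : ℝ),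
      mul_assoc, ENNReal.ofReal_mul (by positivity), ENNReal.ofReal_natCast,
      ENNReal.ofReal_mul zero_le_two, ENNReal.ofReal_ofNat]

end Hoeffding

section EmpiricalCovariance

open scoped MatrixOrder

variable {d n : ℕ} (v : Fin n → EuclideanSpace ℝ (Fin d))

theorem sum_sub_eq_smul_empMean_sub (u : EuclideanSpace ℝ (Fin d)) :
    ∑ i, (v i - u) = (n : ℝ) • (empMean v - u) := by
  rcases n.eq_zero_or_pos with rfl | hn
  · simp
  have hn₀ : (n : ℝ) ≠ 0 := Nat.cast_ne_zero.2 hn.ne'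
  rw [Finset.sum_sub_distrib, smul_sub, empMean, smul_inv_smul₀ hn₀, Finset.sum_const,
    Finset.card_univ, Fintype.card_fin, Nat.cast_smul_eq_nsmul]

theorem frameForm_sub_empMean (u x : EuclideanSpace ℝ (Fin d)) :
    frameForm (fun i => v i - empMean v) x
      = frameForm (fun i => v i - u) x - n * inner ℝ (empMean v - u) x ^ 2 := by
  have hexpand : ∀ i, inner ℝ (v i - empMean v) x ^ 2 = inner ℝ (v i - u) x ^ 2
      - 2 * inner ℝ (empMean v - u) x * inner ℝ (v i - u) x + inner ℝ (empMean v - u) x ^ 2 := by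
    intro i
    rw [← sub_sub_sub_cancel_right (v i) (empMean v) u, inner_sub_left]
    ring
  have hsum : ∑ i, inner ℝ (v i - u) x = n * inner ℝ (empMean v - u) x := by
    rw [← sum_inner, sum_sub_eq_smul_empMean_sub, real_inner_smul_left]
  simp only [frameForm, hexpand]
  rw [Finset.sum_add_distrib, Finset.sum_sub_distrib, ← Finset.mul_sum, hsum, Finset.sum_const,
    Finset.card_univ, Fintype.card_fin, nsmul_eq_mul]
  ring

theorem dotProduct_empCov_mulVec (x : EuclideanSpace ℝ (Fin d)) :
    x.ofLp ⬝ᵥ (empCov v).mulVec x.ofLp = (n : ℝ)⁻¹ * frameForm (fun i => v i - empMean v) x := by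
  rw [empCov, Matrix.smul_mulVec, dotProduct_smul, smul_eq_mul, Matrix.sum_mulVec, dotProduct_sum,
    frameForm]
  congr 1
  refine Finset.sum_congr rfl fun i _ => ?_
  rw [Matrix.vecMulVec_mulVec, EuclideanSpace.inner_eq_star_dotProduct, op_smul_eq_smul,
    dotProduct_smul, star_trivial, smul_eq_mul, dotProduct_comm (v i - empMean v).ofLp, sq]

theorem posSemidef_empCov : (empCov v).PosSemidef := by
  refine .smul (Matrix.posSemidef_sum _ fun i _ => ?_) (by positivity)
  simpa only [star_trivial] using Matrix.posSemidef_vecMulVec_self_star (v i - empMean v).ofLp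

theorem trace_empCov_le (u : EuclideanSpace ℝ (Fin d)) :
    (empCov v).trace ≤ (n : ℝ)⁻¹ * ∑ i, ‖v i - u‖ ^ 2 := by
  have htrace : (empCov v).trace = (n : ℝ)⁻¹ * frameTrace fun i => v i - empMean v := by
    simp only [empCov, frameTrace, Matrix.trace_smul, Matrix.trace_sum, Matrix.trace_vecMulVec,
      smul_eq_mul, EuclideanSpace.real_norm_sq_eq, dotProduct, ← sq]
  have hframe : (frameTrace fun i => v i - empMean v) ≤ frameTrace fun i => v i - u := by
    simp only [frameTrace_eq_sum_frameForm _ (EuclideanSpace.basisFun (Fin d) ℝ)]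
    refine Finset.sum_le_sum fun j _ => ?_
    rw [frameForm_sub_empMean v u]
    exact sub_le_self _ (by positivity)
  rw [htrace]
  exact mul_le_mul_of_nonneg_left hframe (by positivity)

theorem le_empCov_add_smul_one {S : Matrix (Fin d) (Fin d) ℝ} {m : EuclideanSpace ℝ (Fin d)}
    {ε r : ℝ} (hn : 0 < n) (hS : S.IsHermitian) (hmean : ‖empMean v - m‖ ≤ r)
    (hcov : ∀ x : EuclideanSpace ℝ (Fin d),
      x.ofLp ⬝ᵥ S.mulVec x.ofLp - (n : ℝ)⁻¹ * frameForm (fun i => v i - m) x ≤ ε * ‖x‖ ^ 2) :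
    S ≤ empCov v + (ε + r ^ 2) • (1 : Matrix (Fin d) (Fin d) ℝ) := by
  rw [Matrix.le_iff]
  refine .of_dotProduct_mulVec_nonneg
    (((posSemidef_empCov v).isHermitian.add
      (Matrix.isHermitian_one.smul (IsSelfAdjoint.all _))).sub hS) fun y => ?_
  obtain ⟨x, rfl⟩ : ∃ x : EuclideanSpace ℝ (Fin d), x.ofLp = y := ⟨WithLp.toLp 2 y, rfl⟩
  have hnorm : x.ofLp ⬝ᵥ x.ofLp = ‖x‖ ^ 2 := by
    simp only [EuclideanSpace.real_norm_sq_eq, dotProduct, ← sq]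
  have hinner : inner ℝ (empMean v - m) x ^ 2 ≤ r ^ 2 * ‖x‖ ^ 2 := by
    rw [← mul_pow, ← sq_abs]
    exact pow_le_pow_left₀ (abs_nonneg _) ((abs_real_inner_le_norm _ _).trans (by gcongr)) 2
  rw [star_trivial, Matrix.sub_mulVec, Matrix.add_mulVec, Matrix.smul_mulVec, Matrix.one_mulVec,
    dotProduct_sub, dotProduct_add, dotProduct_smul, smul_eq_mul, hnorm,
    dotProduct_empCov_mulVec, frameForm_sub_empMean v m, mul_sub,
    inv_mul_cancel_left₀ (Nat.cast_ne_zero.2 hn.ne')]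
  linarith [hcov x]

end EmpiricalCovariance

section FrechetDistance

open scoped MatrixOrder

variable {d : ℕ} {m m' mr : EuclideanSpace ℝ (Fin d)} {S S' Sr : Matrix (Fin d) (Fin d) ℝ}
  {ε r δ C κ : ℝ}

theorem frechetDist_sub_frechetDist_le (hS : S.PosSemidef) (hS' : S'.PosSemidef) (hSr : Sr.PosDef)
    (hε : 0 ≤ ε) (hmean : ‖m' - m‖ ≤ r) (hcov : S ≤ S' + ε • (1 : Matrix (Fin d) (Fin d) ℝ)) :
    frechetDist m' S' mr Sr - frechetDist m S mr Sr
      ≤ 2 * (r + ‖m' - mr‖) * r + (S'.trace - S.trace) + 2 * √ε * (matSqrt Sr).trace := by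
  have hcross := trace_matSqrt_mul_le hε hS hS' hSr hcov
  have hnorm : ‖m' - mr‖ ≤ r + ‖m - mr‖ :=
    (norm_sub_le_norm_sub_add_norm_sub _ _ _).trans (add_le_add_left hmean _)
  have hr : 0 ≤ r := (norm_nonneg _).trans hmean
  have hsq : ‖m' - mr‖ ^ 2 - ‖m - mr‖ ^ 2 ≤ 2 * (r + ‖m' - mr‖) * r := by
    have hm := norm_nonneg (m - mr)
    have hm' := norm_nonneg (m' - mr)
    rcases le_total ‖m' - mr‖ ‖m - mr‖ with h | h
    · nlinarith
    · nlinarith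
  simp only [frechetDist, Matrix.trace_sub, Matrix.trace_add, Matrix.trace_smul, smul_eq_mul]
  linarith

theorem covErr_nonneg {n : ℕ} : 0 ≤ covErr n δ C κ S := by
  have : 0 ≤ specNorm S := norm_nonneg _
  rw [covErr]
  positivity

theorem frechetDist_sub_boundedBonus_le {n : ℕ} {v : Fin n → EuclideanSpace ℝ (Fin d)}
    (hn : 0 < n) (hS : S.PosSemidef) (hSr : Sr.PosDef)
    (hmean : ‖empMean v - m‖ ≤ meanErr n δ C S)
    (hcov : ∀ x : EuclideanSpace ℝ (Fin d),
      x.ofLp ⬝ᵥ S.mulVec x.ofLp - (n : ℝ)⁻¹ * frameForm (fun i => v i - m) x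
        ≤ 20 * κ ^ 2 * specNorm S * √((4 * effRank S + Real.log (3 / δ)) / n) * ‖x‖ ^ 2)
    (htrace : (n : ℝ)⁻¹ * ∑ i, ‖v i - m‖ ^ 2 - S.trace
      ≤ 4 * C ^ 2 * √(1 / (2 * n) * Real.log (3 / δ))) :
    frechetDist (empMean v) (empCov v) mr Sr - boundedBonus n δ C κ (empMean v) S mr Sr
      ≤ frechetDist m S mr Sr := by
  have hdiff := frechetDist_sub_frechetDist_le (mr := mr) hS (posSemidef_empCov v) hSr
    covErr_nonneg hmean (le_empCov_add_smul_one v hn hS.isHermitian hmean hcov)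
  have hsqrt : 2 * √(covErr n δ C κ S) ≤ √(8 * covErr n δ C κ S) := by
    rw [Real.sqrt_mul (by norm_num)]
    gcongr
    exact Real.le_sqrt_of_sq_le (by norm_num)
  have hcross := mul_le_mul_of_nonneg_right hsqrt (matSqrt_trace_nonneg hSr.posSemidef)
  rw [boundedBonus]
  linarith [trace_empCov_le v m]

end FrechetDistance

section Concentration

variable {𝒳 Ω : Type*} [MeasurableSpace 𝒳] [MeasurableSpace Ω] {P : Measure Ω}
  [IsProbabilityMeasure P] {d n : ℕ} {f : 𝒳 → EuclideanSpace ℝ (Fin d)} {p : Measure 𝒳}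
  [IsProbabilityMeasure p] {X : Fin n → Ω → 𝒳} {C δ : ℝ}

theorem measure_meanErr_lt_le (hn : 0 < n) (hX : ∀ i, HasLaw (X i) p P) (hindep : iIndepFun X P)
    (hf : Measurable f) (hC : 0 < C) (hbound : ∀ᵐ x ∂p, ‖f x‖ ≤ C) (hδ₀ : 0 < δ) (hδ₁ : δ < 1) :
    P {ω | meanErr n δ C (embCov f p) < ‖empMean (fun i => f (X i ω)) - embMean f p‖}
      ≤ ENNReal.ofReal (δ / 3) := by
  have : Nonempty (Fin n) := ⟨⟨0, hn⟩⟩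
  rcases d.eq_zero_or_pos with rfl | hd
  · simp [Subsingleton.elim (_ - embMean f p) 0, meanErr]
  have hd₁ : (1 : ℝ) ≤ d := Nat.one_le_cast.2 hd
  have hlog : 0 ≤ Real.log (6 * d / δ) :=
    Real.log_nonneg ((one_le_div hδ₀).2 (by linarith))
  have htrace : 0 ≤ (embCov f p).trace :=
    (posSemidef_embCov (.of_bound hf.aestronglyMeasurable C hbound)).trace_nonneg
  have htail := measure_lt_norm_mean_sub_le (hindep.comp (fun _ => f) fun _ => hf)
    (fun i => hf.comp_aemeasurable (hX i).aemeasurable) hC 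
    (fun i => ae_of_ae_map (hX i).aemeasurable (by rwa [(hX i).map_eq]))
    (m := embMean f p) (fun i => (hX i).integral_comp hf.aestronglyMeasurable) hlog
  have hprob : 2 * d * Real.exp (-Real.log (6 * d / δ)) = δ / 3 := by
    rw [Real.exp_neg, Real.exp_log (by positivity)]
    field_simp
    norm_num
  simp only [Fintype.card_fin, hprob] at htail
  refine (measure_mono fun ω hω => ?_).trans htail
  refine lt_of_le_of_lt (Real.sqrt_le_sqrt ?_) hω
  exact le_add_of_nonneg_right (by positivity)

theorem measure_lt_mean_sq_norm_sub_trace_embCov_le (hn : 0 < n) (hX : ∀ i, HasLaw (X i) p P)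
    (hindep : iIndepFun X P) (hf : Measurable f) (hC : 0 < C) (hbound : ∀ᵐ x ∂p, ‖f x‖ ≤ C)
    (hδ₀ : 0 < δ) (hδ₁ : δ < 1) :
    P {ω | 4 * C ^ 2 * √(1 / (2 * n) * Real.log (3 / δ))
        < (n : ℝ)⁻¹ * ∑ i, ‖f (X i ω) - embMean f p‖ ^ 2 - (embCov f p).trace}
      ≤ ENNReal.ofReal (δ / 3) := by
  have : Nonempty (Fin n) := ⟨⟨0, hn⟩⟩
  have hmean : ‖embMean f p‖ ≤ C := by
    simpa [embMean] using norm_integral_le_of_norm_le_const hbound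
  have hmem : ∀ᵐ x ∂p, ‖f x - embMean f p‖ ^ 2 ∈ Set.Icc 0 (4 * C ^ 2) := by
    filter_upwards [hbound] with x hx
    refine ⟨sq_nonneg _, ?_⟩
    calc ‖f x - embMean f p‖ ^ 2 ≤ (C + C) ^ 2 := by
          gcongr
          exact (norm_sub_le _ _).trans (add_le_add hx hmean)
      _ = 4 * C ^ 2 := by ring
  have hg : Measurable fun x => ‖f x - embMean f p‖ ^ 2 := by fun_prop
  have htail := measure_le_mean_sub_le (hindep.comp (fun _ => _) fun _ => hg)
    (fun i => hg.comp_aemeasurable (hX i).aemeasurable) (a := 0)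
    (b := 4 * C ^ 2) (by positivity)
    (fun i => ae_of_ae_map (hX i).aemeasurable (by rwa [(hX i).map_eq]))
    (fun i => ((hX i).integral_comp hg.aestronglyMeasurable).trans
      (trace_embCov (.of_bound hf.aestronglyMeasurable C hbound)).symm)
    (Real.log_nonneg ((one_le_div hδ₀).2 (by linarith) : 1 ≤ 3 / δ))
  rw [Real.exp_neg, Real.exp_log (by positivity), inv_div, sub_zero, Fintype.card_fin] at htail
  refine (measure_mono fun ω hω => ?_).trans htail
  rw [Set.mem_ofPred_eq] at hω ⊢
  exact hω.le

theorem ofReal_one_sub_le_measure_of_compl_le {s : Set Ω} (hδ : 0 ≤ δ)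
    (h : P sᶜ ≤ ENNReal.ofReal δ) : ENNReal.ofReal (1 - δ) ≤ P s := by
  rw [ENNReal.ofReal_sub _ hδ, ENNReal.ofReal_one, tsub_le_iff_right, ← measure_univ (μ := P),
    ← Set.union_compl_self s]
  exact (measure_union_le _ _).trans (add_le_add_right h _)

end Concentration

theorem mainTheorem5_general {𝒳 Ω : Type*} [MeasurableSpace 𝒳] [MeasurableSpace Ω]
    (P : Measure Ω) [IsProbabilityMeasure P] {d : ℕ}
    (f : 𝒳 → EuclideanSpace ℝ (Fin d)) (hf : Measurable f)
    (pg : Measure 𝒳) [IsProbabilityMeasure pg]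
    (mr : EuclideanSpace ℝ (Fin d)) (Sr : Matrix (Fin d) (Fin d) ℝ) (hSr : Sr.PosDef)
    (C : ℝ) (hC : 0 < C) (hbound : ∀ᵐ x ∂pg, ‖f x‖ ≤ C)
    (κ : ℝ) (hκ : IsSubGaussianConst f pg κ)
    (δ : ℝ) (hδ0 : 0 < δ) (hδ1 : δ < 1)
    (n : ℕ) (hn : 0 < n) (X : Fin n → Ω → 𝒳)
    (hlaw : ∀ i, HasLaw (X i) pg P) (hindep : iIndepFun X P) :
    ENNReal.ofReal (1 - δ) ≤
      P {ω | frechetDist (empMean fun i => f (X i ω)) (empCov fun i => f (X i ω)) mr Sr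
            - boundedBonus n δ C κ (empMean fun i => f (X i ω)) (embCov f pg) mr Sr
          ≤ frechetDist (embMean f pg) (embCov f pg) mr Sr} := by
  have hf₂ : MemLp f 2 pg := .of_bound hf.aestronglyMeasurable C hbound
  have hlog : Real.log 2 ≤ Real.log (3 / δ) :=
    Real.log_le_log two_pos ((le_div_iff₀ hδ0).2 (by linarith))
  have hexp : Real.exp (-Real.log (3 / δ)) = δ / 3 := by
    rw [Real.exp_neg, Real.exp_log (by positivity), inv_div]
  have hmean := measure_meanErr_lt_le hn hlaw hindep hf hC hbound hδ0 hδ1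
  have hcov := hexp ▸ measure_exists_lt_embCov_sub_le hn hlaw hindep hf hf₂ hκ hlog
  have htrace := measure_lt_mean_sq_norm_sub_trace_embCov_le hn hlaw hindep hf hC hbound hδ0 hδ1
  refine ofReal_one_sub_le_measure_of_compl_le hδ0.le ((measure_mono fun ω hω => ?_).trans
    (((measure_union_le _ _).trans (add_le_add ((measure_union_le _ _).trans
      (add_le_add hmean hcov)) htrace)).trans_eq ?_))
  · by_contra hgood
    simp only [Set.mem_union, Set.mem_ofPred_eq, not_or, not_exists, not_lt] at hgood
    exact hω (frechetDist_sub_boundedBonus_le hn (posSemidef_embCov hf₂) hSr hgood.1.1 hgood.1.2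
      hgood.2)
  · rw [← ENNReal.ofReal_add (by positivity) (by positivity),
      ← ENNReal.ofReal_add (by positivity) (by positivity)]
    congr 1
    ring

theorem mainTheorem5 {𝒳 Ω : Type*} [MeasurableSpace 𝒳] [MeasurableSpace Ω]
    (P : Measure Ω) [IsProbabilityMeasure P] {d : ℕ}
    (f : 𝒳 → EuclideanSpace ℝ (Fin d)) (hf : Measurable f)
    (pg pr : Measure 𝒳) [IsProbabilityMeasure pg] [IsProbabilityMeasure pr]
    (hfr : MemLp f 2 pr) (hSr : (embCov f pr).PosDef)
    (C : ℝ) (hC : 0 < C) (hbound : ∀ᵐ x ∂pg, ‖f x‖ ≤ C)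
    (κ : ℝ) (hκ : IsSubGaussianConst f pg κ)
    (δ : ℝ) (hδ0 : 0 < δ) (hδ1 : δ < 1)
    (n : ℕ) (hn : 0 < n) (X : Fin n → Ω → 𝒳)
    (hlaw : ∀ i, HasLaw (X i) pg P) (hindep : iIndepFun X P) :
    ENNReal.ofReal (1 - δ) ≤
      P {ω | frechetDist (empMean fun i => f (X i ω)) (empCov fun i => f (X i ω))
              (embMean f pr) (embCov f pr)
            - boundedBonus n δ C κ (empMean fun i => f (X i ω)) (embCov f pg)
              (embMean f pr) (embCov f pr)
          ≤ frechetDist (embMean f pg) (embCov f pg) (embMean f pr) (embCov f pr)} := by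
  exact mainTheorem5_general P f hf pg _ _ hSr C hC hbound κ hκ δ hδ0 hδ1 n hn X hlaw hindep
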